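/- Let $1\le d\le N-1$ and let $I_{d,N}$ be the set of tuples $(i_1,\dots,i_d)$ with $1\le i_1<\dots<i_d\le N$ (also regarded as $d$-element subsets of $\{1,\dots,N\}$). For $w\in I_{d,N}$ let $X(w)\subseteq\mathbb P(\bigwedge^d\mathbb C^N)$ be the Schubert variety, i.e. the Zariski closure of the orbit $B[e_w]$, $B\subset GL_N(\mathbb C)$ being the group of upper triangular matrices; let $\mathbb C[X(w)]$ be its homogeneous coordinate ring, $p_\tau$ the Plücker coordinates (dual to the basis $e_\tau=e_{i_1}\wedge\dots\wedge e_{i_d}$), and order $I_{d,N}$ by the Bruhat order: $\tau\le\tau'$ iff $X(\tau)\subseteq X(\tau')$. Put $H_w=\{\tau\in I_{d,N}:\tau\le w\}$. For $A\subseteq\{1,\dots,N-1\}$ let $P_A=\bigcap_{m\in\{1,\dots,N-1\}\setminus A}P_m$ be the standard parabolic subgroup, where $P_m$ is the group of matrices in $GL_N(\mathbb C)$ whose lower left $(N-m)\times m$ block is zero. Suppose that $Q=P_A$ is contained in the stabilizer $Q_w$ of $X(w)$ in $GL_N(\mathbb C)$. Let $L$ be the Levi part of $Q$: writing $\{1,\dots,N-1\}\setminus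 A=\{a_1<\dots<a_{k-1}\}$, $a_0=0$, $a_k=N$, it is the group of invertible block diagonal matrices for the blocks $\{a_{j-1}+1,\dots,a_j\}$, $1\le j\le k$. It acts on $\mathbb C[X(w)]$ by $(g\cdot f)(v)=f(g^{-1}v)$. An element $\theta\in H_w$ is a head of type $L$ if, in each block, every element of $\theta$ is larger than every element of the block that is not in $\theta$. In the Hasse diagram of $H_w$ label the edge joining $\tau\lessdot\varphi$ with $\tau=s_m\varphi$ by $m$, where $s_m$ is the transposition $(m,m+1)$, and keep only the edges with label in $A$. Then for every $\tau\in H_w$ there is exactly one head of type $L$ connected to $\tau$ in the resulting diagram; denote it by $\theta_\tau$. Let $r\ge0$. A monomial $p_{\gamma_1}\cdots p_{\gamma_r}$ with $\gamma_i\in H_w$ is standard if $\gamma_1\ge\dots\ge\gamma_r$; let $\mathrm{Std}_r$ be the set of these. For sequences of elements of $H_w$ write $(\theta_1,\dots,\theta_r)>_{str}(\theta_1',\dots,\theta_r')$ if for some $q$ we have $\theta_n=\theta'_n$ for all $n<q$ and $\theta_q>\theta_q'$, and let $\ge_{str}$ mean $>_{str}$ or equal. (1) For all $\tau_1,\dots,\tau_r\in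 H_w$ there is a unique expression $$p_{\tau_1}\cdots p_{\tau_r}=\sum_{p_{\gamma_1}\cdots p_{\gamma_r}\in \mathrm{Std}_r}a_{\gamma_1,\dots,\gamma_r}\,p_{\gamma_1}\cdots p_{\gamma_r},\qquad a_{\gamma_1,\dots,\gamma_r}\in\mathbb C,$$ in $\mathbb C[X(w)]$, and $(\theta_{\gamma_1},\dots,\theta_{\gamma_r})\ge_{str}(\theta_{\tau_1},\dots,\theta_{\tau_r})$ whenever $a_{\gamma_1,\dots,\gamma_r}\ne0$. (2) Let $\underline\theta=(\theta_1,\dots,\theta_r)$ be a sequence of heads of type $L$ with $\theta_1\ge\dots\ge\theta_r$. Let $\mathrm{Std}_{\underline\theta}^{\ge_{str}}$ (respectively $\mathrm{Std}_{\underline\theta}^{>_{str}}$) be the set of $p_{\tau_1}\cdots p_{\tau_r}\in\mathrm{Std}_r$ with $(\theta_{\tau_1},\dots,\theta_{\tau_r})\ge_{str}\underline\theta$ (respectively $>_{str}\underline\theta$). Then the linear spans of $\mathrm{Std}_{\underline\theta}^{\ge_{str}}$ and of $\mathrm{Std}_{\underline\theta}^{>_{str}}$ in $\mathbb C[X(w)]$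 are $L$-stable. -/

import Mathlib

open scoped LinearAlgebra.Projectivization

noncomputable section

namespace SchubertLevi

/-! ### The Plücker embedding -/

/-- The exterior power `⋀^d ℂ^N`. -/
abbrev Ext (N d : ℕ) : Type := ⋀[ℂ]^d (Fin N → ℂ)

/-- The index set `I_{d,N}`: increasing `d`-tuples in `{1, …, N}`, encoded as `d`-element subsets of
`Fin N`. The element `i : Fin N` stands for the integer `i.val + 1 ∈ {1, …, N}`. -/
def Idx (N d : ℕ) : Type := Set.powersetCard (Fin N) d

instance (N d : ℕ) : Fintype (Idx N d) := inferInstanceAs (Fintype (Set.powersetCard (Fin N) d))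

/-- The underlying `d`-element subset of an index. -/
def Idx.toFinset {N d : ℕ} (τ : Idx N d) : Finset (Fin N) := τ.1

/-- The basis `e_τ = e_{i_1} ∧ ⋯ ∧ e_{i_d}` (`i_1 < ⋯ < i_d` the elements of `τ`) of `⋀^d ℂ^N`. -/
def extBasis (N d : ℕ) : Module.Basis (Idx N d) ℂ (Ext N d) :=
  (Pi.basisFun ℂ (Fin N)).exteriorPower d

/-- The Plücker coordinates: the basis of `(⋀^d ℂ^N)^*` dual to the basis `e_τ`. -/
def plucker {N d : ℕ} (τ : Idx N d) : Ext N d →ₗ[ℂ] ℂ := (extBasis N d).coord τ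

/-- The ring of polynomials in the Plücker coordinates, the homogeneous coordinate ring of
`ℙ(⋀^d ℂ^N)`. -/
abbrev PolyRing (N d : ℕ) : Type := MvPolynomial (Idx N d) ℂ

/-- The value of a polynomial in the Plücker coordinates at a vector of `⋀^d ℂ^N`. -/
def evalAt {N d : ℕ} (v : Ext N d) (f : PolyRing N d) : ℂ :=
  MvPolynomial.eval (fun τ => plucker τ v) f

/-- A polynomial vanishes at a point of projective space if it vanishes at all vectors
representing the point. -/
def VanishesAt {N d : ℕ} (f : PolyRing N d) (x : ℙ ℂ (Ext N d)) : Prop :=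
  ∀ (v : Ext N d) (hv : v ≠ 0), Projectivization.mk ℂ v hv = x → evalAt v f = 0

/-- Closure in the Zariski topology of `ℙ(⋀^d ℂ^N)`. -/
def zariskiClosure {N d : ℕ} (S : Set (ℙ ℂ (Ext N d))) : Set (ℙ ℂ (Ext N d)) :=
  {x | ∀ (n : ℕ) (f : PolyRing N d), f.IsHomogeneous n →
    (∀ y ∈ S, VanishesAt f y) → VanishesAt f x}

/-! ### The action of `GL_N` and Schubert varieties -/

/-- The action of `g ∈ GL_N` on `⋀^d ℂ^N`. -/
def extMap {N : ℕ} (d : ℕ) (g : GL (Fin N) ℂ) : Ext N d →ₗ[ℂ] Ext N d :=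
  exteriorPower.map d (Matrix.toLin' (g : Matrix (Fin N) (Fin N) ℂ))

theorem extMap_one {N d : ℕ} : extMap d (1 : GL (Fin N) ℂ) = LinearMap.id := by
  simp [extMap]

theorem extMap_mul {N d : ℕ} (g h : GL (Fin N) ℂ) :
    extMap d (g * h) = extMap d g ∘ₗ extMap d h := by
  simp [extMap, Matrix.toLin'_mul, exteriorPower.map_comp]

theorem extMap_injective {N d : ℕ} (g : GL (Fin N) ℂ) : Function.Injective (extMap d g) := by
  apply Function.LeftInverse.injective (g := extMap d g⁻¹)
  intro v
  rw [← LinearMap.comp_apply, ← extMap_mul, inv_mul_cancel, extMap_one, LinearMap.id_apply]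

/-- The action of `g ∈ GL_N` on `ℙ(⋀^d ℂ^N)`. -/
def projMap {N : ℕ} (d : ℕ) (g : GL (Fin N) ℂ) : ℙ ℂ (Ext N d) → ℙ ℂ (Ext N d) :=
  Projectivization.map (extMap d g) (extMap_injective g)

theorem projMap_one {N d : ℕ} (x : ℙ ℂ (Ext N d)) : projMap d (1 : GL (Fin N) ℂ) x = x := by
  induction x using Projectivization.ind with
  | h v hv => simp [projMap, Projectivization.map_mk, extMap_one]

theorem projMap_mul {N d : ℕ} (g h : GL (Fin N) ℂ) (x : ℙ ℂ (Ext N d)) :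
    projMap d (g * h) x = projMap d g (projMap d h x) := by
  induction x using Projectivization.ind with
  | h v hv => simp [projMap, Projectivization.map_mk, extMap_mul]

/-- The Borel subgroup `B` of invertible upper triangular matrices. -/
def borel (N : ℕ) : Set (GL (Fin N) ℂ) :=
  {b | ∀ i j : Fin N, j < i → (b : Matrix (Fin N) (Fin N) ℂ) i j = 0}

/-- The `T`-fixed point `[e_w]`. -/
def fixedPoint {N d : ℕ} (w : Idx N d) : ℙ ℂ (Ext N d) :=
  Projectivization.mk ℂ (extBasis N d w) ((extBasis N d).ne_zero w)

/-- The Schubert variety `X(w)`: the Zariski closure of the orbit `B[e_w]` (inside the image of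
the Grassmannian under the Plücker embedding). -/
def schubert {N d : ℕ} (w : Idx N d) : Set (ℙ ℂ (Ext N d)) :=
  zariskiClosure {x | ∃ b ∈ borel N, x = projMap d b (fixedPoint w)}

/-- The Bruhat order on `I_{d,N}`: `τ ≤ w` iff `X(τ) ⊆ X(w)`. -/
instance (N d : ℕ) : Preorder (Idx N d) := Preorder.lift schubert

/-- The stabilizer `Q_w` of `X(w)` in `GL_N`. -/
def stabilizer {N d : ℕ} (w : Idx N d) : Subgroup (GL (Fin N) ℂ) where
  carrier := {g | projMap d g '' schubert w = schubert w}
  one_mem' := by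
    change projMap d 1 '' schubert w = schubert w
    rw [show projMap d (1 : GL (Fin N) ℂ) = id from funext projMap_one, Set.image_id]
  mul_mem' := by
    intro g h hg hh
    change projMap d (g * h) '' schubert w = schubert w
    rw [show projMap d (g * h) = projMap d g ∘ projMap d h from funext (projMap_mul g h),
      Set.image_comp, show projMap d h '' schubert w = schubert w from hh]
    exact hg
  inv_mem' := by
    intro g hg
    change projMap d g⁻¹ '' schubert w = schubert w
    have hg' : projMap d g '' schubert w = schubert w := hg
    conv_lhs => rw [← hg']
    rw [← Set.image_comp,
      show projMap d g⁻¹ ∘ projMap d g = id from funext fun x => by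
        rw [Function.comp_apply, ← projMap_mul, inv_mul_cancel, projMap_one, id_eq],
      Set.image_id]

/-! ### The homogeneous coordinate ring and the action on it -/

/-- The ideal of polynomials vanishing on `X(w)`. As `VanishesAt` refers to all representatives of
a point and `ℂ` is infinite, this is the homogeneous vanishing ideal of `X(w)`. -/
def vanishingIdeal {N d : ℕ} (w : Idx N d) : Ideal (PolyRing N d) where
  carrier := {f | ∀ x ∈ schubert w, VanishesAt f x}
  zero_mem' := by intro x _ v hv _; simp [evalAt]
  add_mem' := by
    intro f g hf hg x hx v hv h
    have h1 := hf x hx v hv h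
    have h2 := hg x hx v hv h
    simp only [evalAt, map_add] at *
    rw [h1, h2, add_zero]
  smul_mem' := by
    intro c f hf x hx v hv h
    have h1 := hf x hx v hv h
    simp only [evalAt, smul_eq_mul, map_mul] at *
    rw [h1, mul_zero]

/-- The homogeneous coordinate ring `ℂ[X(w)]` for the Plücker embedding. -/
abbrev CoordRing {N d : ℕ} (w : Idx N d) : Type := PolyRing N d ⧸ vanishingIdeal w

/-- The Plücker coordinate `p_τ` as an element of `ℂ[X(w)]`. -/
def pl {N d : ℕ} (w τ : Idx N d) : CoordRing w :=
  Ideal.Quotient.mk (vanishingIdeal w) (MvPolynomial.X τ)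

/-- The action of `g ∈ GL_N` on polynomials, `(g • f)(v) = f(g⁻¹ v)`: the algebra map sending the
coordinate `p_τ` to the linear form `p_τ ∘ g⁻¹ = ∑_φ p_τ(g⁻¹ e_φ) p_φ`. -/
def polyAct {N d : ℕ} (g : GL (Fin N) ℂ) : PolyRing N d →ₐ[ℂ] PolyRing N d :=
  MvPolynomial.aeval fun τ =>
    ∑ φ : Idx N d, MvPolynomial.C (plucker τ (extMap d g⁻¹ (extBasis N d φ))) * MvPolynomial.X φ

theorem evalAt_polyAct {N d : ℕ} (g : GL (Fin N) ℂ) (v : Ext N d) (f : PolyRing N d) :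
    evalAt v (polyAct g f) = evalAt (extMap d g⁻¹ v) f := by
  have key : ∀ τ : Idx N d, plucker τ (extMap d g⁻¹ v) =
      ∑ φ : Idx N d, plucker τ (extMap d g⁻¹ (extBasis N d φ)) * plucker φ v := by
    intro τ
    conv_lhs => rw [← (extBasis N d).sum_repr v]
    rw [map_sum, map_sum]
    refine Finset.sum_congr rfl fun φ _ => ?_
    rw [map_smul, map_smul, smul_eq_mul, mul_comm]
    rfl
  unfold evalAt polyAct
  induction f using MvPolynomial.induction_on with
  | C a => simp
  | add p q hp hq => simp only [map_add, hp, hq]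
  | mul_X p τ hp =>
    rw [map_mul, map_mul, map_mul, hp]
    simp [key]

theorem vanishingIdeal_le_comap {N d : ℕ} (w : Idx N d) (g : stabilizer w) :
    vanishingIdeal w ≤ (vanishingIdeal w).comap (polyAct (g : GL (Fin N) ℂ)) := by
  intro f hf x hx v hv h
  rw [evalAt_polyAct]
  have hne : extMap d (g : GL (Fin N) ℂ)⁻¹ v ≠ 0 := fun h0 =>
    hv (extMap_injective _ (by rw [h0, map_zero]))
  refine hf (projMap d (g : GL (Fin N) ℂ)⁻¹ x) ?_ _ hne ?_
  · have hg : projMap d (g : GL (Fin N) ℂ)⁻¹ '' schubert w = schubert w :=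
      (stabilizer w).inv_mem g.2
    rw [← hg]
    exact Set.mem_image_of_mem _ hx
  · rw [← h, projMap, Projectivization.map_mk]

/-- The action of `g ∈ Q_w` on `ℂ[X(w)]` induced by left multiplication on `X(w)`:
`(g • f)(v) = f(g⁻¹ v)`. -/
def coordAct {N d : ℕ} (w : Idx N d) (g : stabilizer w) : CoordRing w →ₐ[ℂ] CoordRing w :=
  Ideal.quotientMapₐ (vanishingIdeal w) (polyAct (g : GL (Fin N) ℂ)) (vanishingIdeal_le_comap w g)

/-! ### Parabolic subgroups, blocks and the Levi part -/

/-- The maximal parabolic subgroup `P_m`: the lower left block, formed by the last `N - m` rows and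
the first `m` columns, is zero. -/
def maxParabolic (N m : ℕ) : Subgroup (GL (Fin N) ℂ) where
  carrier := {g | ∀ i j : Fin N, j.val < m → m ≤ i.val → (g : Matrix (Fin N) (Fin N) ℂ) i j = 0}
  one_mem' := by
    intro i j hj hi
    simp only [Units.val_one]
    exact Matrix.one_apply_ne (by rintro rfl; omega)
  mul_mem' := by
    intro g h hg hh i j hj hi
    simp only [Units.val_mul, Matrix.mul_apply]
    refine Finset.sum_eq_zero fun k _ => ?_
    rcases lt_or_ge k.val m with hk | hk
    · rw [hg i k hk hi, zero_mul]
    · rw [hh k j hj hk, mul_zero]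
  inv_mem' := by
    intro g hg i j hj hi
    have hT : (g : Matrix (Fin N) (Fin N) ℂ).BlockTriangular
        (fun i : Fin N => if i.val < m then (0 : ℕ) else 1) := by
      intro a b hab
      refine hg a b ?_ ?_ <;> by_contra hc <;> simp only at hab <;> split_ifs at hab <;> omega
    have := Matrix.blockTriangular_inv_of_blockTriangular hT
    rw [← Matrix.coe_units_inv] at this
    refine this ?_
    simp only [if_pos hj, if_neg (not_lt.mpr hi), zero_lt_one]

/-- The standard parabolic subgroup `P_A` attached to `A ⊆ {1, …, N-1}`: the intersection of the
`P_m` with `m ∈ {1, …, N-1} \ A`. -/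
def parabolic (N : ℕ) (A : Finset ℕ) : Subgroup (GL (Fin N) ℂ) :=
  ⨅ m ∈ Finset.Icc 1 (N - 1) \ A, maxParabolic N m

/-- The (number of the) block containing an element of `{1, …, N}`. Writing
`{1, …, N-1} \ A = {a_1 < a_2 < ⋯}`, the blocks are `{1, …, a_1}, {a_1 + 1, …, a_2}, …`; they are
numbered from `0` here. As `i : Fin N` stands for `i.val + 1`, the number of its block is the number
of the `a_k` smaller than `i.val + 1`. -/
def block {N : ℕ} (A : Finset ℕ) (i : Fin N) : ℕ :=
  ((Finset.Icc 1 (N - 1) \ A).filter fun a => a ≤ i.val).card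

/-- The Levi part `L` of `P_A`: the block diagonal invertible matrices. -/
def levi (N : ℕ) (A : Finset ℕ) : Subgroup (GL (Fin N) ℂ) where
  carrier := {g | ∀ i j : Fin N, block A i ≠ block A j → (g : Matrix (Fin N) (Fin N) ℂ) i j = 0}
  one_mem' := by
    intro i j hij
    simp only [Units.val_one]
    exact Matrix.one_apply_ne (by rintro rfl; exact hij rfl)
  mul_mem' := by
    intro g h hg hh i j hij
    simp only [Units.val_mul, Matrix.mul_apply]
    refine Finset.sum_eq_zero fun k _ => ?_
    by_cases hk : block A i = block A k
    · rw [hh k j (hk ▸ hij), mul_zero]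
    · rw [hg i k hk, zero_mul]
  inv_mem' := by
    intro g hg i j hij
    have h1 : (g : Matrix (Fin N) (Fin N) ℂ).BlockTriangular (block A) :=
      fun a b hab => hg a b (ne_of_gt hab)
    have h2 : (g : Matrix (Fin N) (Fin N) ℂ).BlockTriangular
        (fun i => OrderDual.toDual (block A i)) :=
      fun a b hab => hg a b (ne_of_lt (OrderDual.toDual_lt_toDual.mp hab))
    have h1' := Matrix.blockTriangular_inv_of_blockTriangular h1
    have h2' := Matrix.blockTriangular_inv_of_blockTriangular h2
    rw [← Matrix.coe_units_inv] at h1' h2'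
    rcases lt_or_gt_of_ne hij with h | h
    · exact h2' (OrderDual.toDual_lt_toDual.mpr h)
    · exact h1' h

theorem levi_le_parabolic (N : ℕ) (A : Finset ℕ) : levi N A ≤ parabolic N A := by
  intro g hg
  simp only [parabolic, Subgroup.mem_iInf]
  intro m hm i j hj hi
  refine hg i j (ne_of_gt ?_)
  apply Finset.card_lt_card
  rw [Finset.ssubset_iff_of_subset]
  · refine ⟨m, Finset.mem_filter.mpr ⟨hm, hi⟩, fun h => ?_⟩
    have := (Finset.mem_filter.mp h).2
    omega
  · intro a ha
    rw [Finset.mem_filter] at ha ⊢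
    exact ⟨ha.1, by omega⟩

/-! ### Heads -/

/-- `H_w = {τ ∈ I_{d,N} | τ ≤ w}`. -/
abbrev H {N d : ℕ} (w : Idx N d) : Type := Set.Iic w

/-- `τ` is a head of type `L`: in every block, the elements of `τ` are larger than all the elements
of the block outside `τ`. -/
def IsHead {N d : ℕ} (A : Finset ℕ) (τ : Idx N d) : Prop :=
  ∀ m ∈ τ.toFinset, ∀ n ∉ τ.toFinset, block A m = block A n → n < m

/-- The simple transposition `s_{α_m} = (m, m+1)` of `{1, …, N}`, for `1 ≤ m ≤ N - 1` (and the
identity for `m ≥ N`). -/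
def simpleRefl (N m : ℕ) : Equiv.Perm (Fin N) :=
  if h : m < N then Equiv.swap ⟨m - 1, by omega⟩ ⟨m, h⟩ else 1

/-- The Hasse diagram of `H_w` with only the edges labelled `s_{α_m}`, `m ∈ A`, kept; the edge joining
`τ ⋖ φ` has the label `s_{α_m}` if `τ = s_{α_m} φ`. -/
def hasse {N d : ℕ} (A : Finset ℕ) (w : Idx N d) : SimpleGraph (H w) :=
  SimpleGraph.fromRel fun τ φ =>
    τ ⋖ φ ∧ ∃ m ∈ A, τ.1.toFinset = φ.1.toFinset.map (simpleRefl N m).toEmbedding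

/-- `θ` is a head of type `L` connected to `τ` in the diagram `hasse A w`. -/
def IsHeadOf {N d : ℕ} (A : Finset ℕ) (w : Idx N d) (τ θ : H w) : Prop :=
  IsHead A θ.1 ∧ (hasse A w).Reachable τ θ

/-- The head `θ_τ` of `τ`: the unique head of type `L` connected to `τ`. -/
def head {N d : ℕ} (A : Finset ℕ) (w : Idx N d) (τ : H w) : H w :=
  @Classical.epsilon _ ⟨τ⟩ (IsHeadOf A w τ)

/-! ### The order on degree `r` heads, standard monomials -/

/-- `StrGT θ θ'` is `θ >_str θ'`. -/
def StrGT {N d r : ℕ} {w : Idx N d} (θ θ' : Fin r → H w) : Prop :=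
  ∃ q : Fin r, (∀ n, n < q → θ n = θ' n) ∧ θ q > θ' q

/-- `StrGE θ θ'` is `θ ≥_str θ'`. -/
def StrGE {N d r : ℕ} {w : Idx N d} (θ θ' : Fin r → H w) : Prop :=
  StrGT θ θ' ∨ θ = θ'

/-- The monomial `p_{τ_1} ⋯ p_{τ_r}` in `ℂ[X(w)]`. -/
def mono {N d r : ℕ} (w : Idx N d) (τ : Fin r → H w) : CoordRing w := ∏ i, pl w (τ i).1

/-- `τ_1 ≥ ⋯ ≥ τ_r`. -/
def IsStd {N d r : ℕ} {w : Idx N d} (τ : Fin r → H w) : Prop := ∀ i j, i ≤ j → τ j ≤ τ i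

/-- The index set of the degree `r` standard monomials on `X(w)`. -/
def StdTuple {N d : ℕ} (w : Idx N d) (r : ℕ) : Type := {τ : Fin r → H w // IsStd τ}

instance {N d : ℕ} (w : Idx N d) (r : ℕ) : Fintype (StdTuple w r) :=
  haveI : Finite (StdTuple w r) := inferInstanceAs (Finite {τ : Fin r → H w // IsStd τ})
  Fintype.ofFinite _

/-- A standard degree `r` head: a sequence `θ_1 ≥ ⋯ ≥ θ_r` of heads of type `L`. -/
def IsStdHead {N d r : ℕ} (A : Finset ℕ) {w : Idx N d} (θ : Fin r → H w) : Prop :=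
  (∀ i, IsHead A (θ i).1) ∧ IsStd θ

/-- The set `Std_θ^{≥_str}` of standard monomials whose degree `r` head is `≥_str θ`. -/
def StdGE {N d r : ℕ} (A : Finset ℕ) (w : Idx N d) (θ : Fin r → H w) : Set (CoordRing w) :=
  {f | ∃ τ : Fin r → H w, IsStd τ ∧ StrGE (fun i => head A w (τ i)) θ ∧ f = mono w τ}

/-- The set `Std_θ^{>_str}` of standard monomials whose degree `r` head is `>_str θ`. -/
def StdGT {N d r : ℕ} (A : Finset ℕ) (w : Idx N d) (θ : Fin r → H w) : Set (CoordRing w) :=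
  {f | ∃ τ : Fin r → H w, IsStd τ ∧ StrGT (fun i => head A w (τ i)) θ ∧ f = mono w τ}

end SchubertLevi

end

open scoped LinearAlgebra.Projectivization

noncomputable section

namespace SchubertLevi

section

variable {N d : ℕ}

/-! ### Indices as increasing sequences -/

/-! Everything is read off from the counts `cnt m τ`, the number of elements of `τ` whose value is
below `m`. The Bruhat order is the componentwise order of increasing sequences, equivalently the
reverse order on all counts (`le_iff_enum`, `le_iff_cnt`). The values `m ∉ A` are the block
boundaries. Boundary counts do not change along edges with label in `A`, and a head is the largest
index with its boundary counts (`IsAdmissible.le_of_isHead`). Hence `θ_τ` exists uniquely, depends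
only on the boundary counts of `τ`, and grows when they shrink.

Straightening starts from Plücker relations obtained by antisymmetrizing `d + 1` rows in a product
of two minors. They preserve content and push the two factors apart in `rank`, so iteration
terminates and standard monomials span. Standard monomials are independent by induction on the
degree and on `w`: restrict to smaller Schubert varieties, then cancel `p_w`. Restricting in the
same way the standard expansion of `p_τ p_φ` to the variety of the first factor of a term shows that
this factor lies above both `τ` and `φ` (`pl_mul_mem_span_bounds`).

Straightening again with these sharper relations replaces a pair of counts by a more spread-out pair
with the same sum. So sums of the convex functions `max (c - cnt m) 0` never decrease, and for
standard terms this majorization bounds the partial sums of counts (`sum_cnt_le_of_majorized`). At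
the first place where the heads differ, the earlier boundary counts cancel, and the new head is
larger (`IsAdmissible.strGE_head`).

For stability, a block diagonal matrix takes `p_τ` to a combination of `p_φ` with the same boundary
counts, hence the same head for `φ ≤ w`; straightening the resulting products can only raise the
heads. -/

/-- The increasing enumeration of an index. -/
def Idx.enum (τ : Idx N d) : Fin d ↪o Fin N := τ.1.orderEmbOfFin τ.2

theorem Idx.ext_toFinset {τ φ : Idx N d} (h : τ.toFinset = φ.toFinset) : τ = φ := Subtype.ext h

theorem Idx.card_toFinset (τ : Idx N d) : τ.toFinset.card = d := τ.2

theorem Idx.image_enum (τ : Idx N d) : Finset.univ.image τ.enum = τ.toFinset :=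
  Finset.image_orderEmbOfFin_univ _ _

theorem Idx.mem_toFinset_iff (τ : Idx N d) (j : Fin N) : j ∈ τ.toFinset ↔ ∃ i, τ.enum i = j := by
  simp [← τ.image_enum]

theorem Idx.enum_mem (τ : Idx N d) (i : Fin d) : τ.enum i ∈ τ.toFinset :=
  (τ.mem_toFinset_iff _).2 ⟨i, rfl⟩

theorem Idx.enum_injective : Function.Injective (Idx.enum : Idx N d → _) := by
  intro τ φ h
  apply Idx.ext_toFinset
  rw [← τ.image_enum, ← φ.image_enum, h]

/-- The sum of an integral weight over an index. -/
def wsum (g : Fin N → ℤ) (τ : Idx N d) : ℤ := ∑ i ∈ τ.toFinset, g i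

theorem wsum_eq_sum_enum (g : Fin N → ℤ) (τ : Idx N d) : wsum g τ = ∑ i, g (τ.enum i) := by
  rw [wsum, ← τ.image_enum, Finset.sum_image fun _ _ _ _ h => τ.enum.injective h]

/-- The number of elements of `τ` whose value is smaller than `m`. -/
def cnt (m : ℕ) (τ : Idx N d) : ℤ := wsum (fun i => if i.val < m then 1 else 0) τ

/-- The sum of the elements of `τ`. -/
def rank (τ : Idx N d) : ℤ := wsum (fun i => (i.val : ℤ)) τ

theorem cnt_eq_card (m : ℕ) (τ : Idx N d) :
    cnt m τ = (Finset.univ.filter fun i => (τ.enum i).val < m).card := by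
  rw [cnt, wsum_eq_sum_enum, Finset.sum_boole]

theorem cnt_eq_card_filter (m : ℕ) (τ : Idx N d) :
    cnt m τ = (τ.toFinset.filter fun i => i.val < m).card := by
  rw [cnt, wsum, Finset.sum_boole]

/-- Count below `φ.enum i + 1`: `φ` has at least `i + 1` elements there, while `φ.enum i < τ.enum i`
would leave at most `i` for `τ`. -/
theorem enum_le_of_cnt_le {τ φ : Idx N d} (h : ∀ m, cnt m φ ≤ cnt m τ) (i : Fin d) :
    τ.enum i ≤ φ.enum i := by
  by_contra! hlt
  have := h ((φ.enum i).val + 1)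
  rw [cnt_eq_card, cnt_eq_card, Nat.cast_le] at this
  have h1 : Finset.Iic i ⊆ Finset.univ.filter fun j => (φ.enum j).val < (φ.enum i).val + 1 := by
    intro j hj
    rw [Finset.mem_Iic] at hj
    have : φ.enum j ≤ φ.enum i := φ.enum.monotone hj
    simp only [Finset.mem_filter, Finset.mem_univ, true_and]
    omega
  have h2 : (Finset.univ.filter fun j => (τ.enum j).val < (φ.enum i).val + 1) ⊆ Finset.Iio i := by
    intro j hj
    simp only [Finset.mem_filter, Finset.mem_univ, true_and] at hj
    rw [Finset.mem_Iio, ← τ.enum.lt_iff_lt]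
    omega
  have h1' := Finset.card_le_card h1
  have h2' := Finset.card_le_card h2
  rw [Fin.card_Iic] at h1'
  rw [Fin.card_Iio] at h2'
  omega

theorem cnt_le_of_enum_le {τ φ : Idx N d} (h : ∀ i, τ.enum i ≤ φ.enum i) (m : ℕ) :
    cnt m φ ≤ cnt m τ := by
  rw [cnt_eq_card, cnt_eq_card, Nat.cast_le]
  refine Finset.card_le_card fun j hj => ?_
  have := h j
  simp only [Finset.mem_filter, Finset.mem_univ, true_and] at hj ⊢
  omega

/-- Pigeonhole: if `φ.enum i < τ.enum i`, then `σ` would map the `i + 1` positions up to `i`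
injectively into the `i` positions before `i`. -/
theorem enum_le_of_perm {τ φ : Idx N d} (σ : Equiv.Perm (Fin d))
    (h : ∀ i, τ.enum (σ i) ≤ φ.enum i) (i : Fin d) : τ.enum i ≤ φ.enum i := by
  by_contra! hlt
  have h1 : (Finset.Iic i).image σ ⊆ Finset.Iio i := by
    intro j hj
    obtain ⟨k, hk, rfl⟩ := Finset.mem_image.1 hj
    rw [Finset.mem_Iio, ← τ.enum.lt_iff_lt]
    exact ((h k).trans (φ.enum.monotone (Finset.mem_Iic.1 hk))).trans_lt hlt
  have h2 := Finset.card_le_card h1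
  rw [Finset.card_image_of_injective _ σ.injective, Fin.card_Iic, Fin.card_Iio] at h2
  omega

/-! ### Minors -/

/-- The minor of `M` with rows `τ` and columns `w`. -/
def minor (M : Matrix (Fin N) (Fin N) ℂ) (τ w : Idx N d) : ℂ := (M.submatrix τ.enum w.enum).det

theorem ιMultiDual_map_ιMulti_family (M : Matrix (Fin N) (Fin N) ℂ)
    (τ w : Set.powersetCard (Fin N) d) :
    exteriorPower.ιMultiDual ℂ d (Pi.basisFun ℂ (Fin N)) τ (exteriorPower.map d (Matrix.toLin' M)
      (exteriorPower.ιMulti_family ℂ d (Pi.basisFun ℂ (Fin N)) w)) =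
      (M.submatrix (τ.1.orderEmbOfFin τ.2) (w.1.orderEmbOfFin w.2)).det := by
  rw [exteriorPower.map_apply_ιMulti_family, exteriorPower.ιMulti_family,
    exteriorPower.ιMultiDual_apply_ιMulti, ← Matrix.det_transpose]
  congr 1
  ext i j
  simp [Set.powersetCard.ofFinEmbEquiv_symm_apply]

theorem plucker_extMap (g : GL (Fin N) ℂ) (τ w : Idx N d) :
    plucker τ (extMap d g (extBasis N d w)) = minor (g : Matrix (Fin N) (Fin N) ℂ) τ w := by
  have h1 : plucker τ = exteriorPower.ιMultiDual ℂ d (Pi.basisFun ℂ (Fin N)) τ :=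
    exteriorPower.basis_coord ℂ d (Pi.basisFun ℂ (Fin N)) τ
  have h2 : extBasis N d w = exteriorPower.ιMulti_family ℂ d (Pi.basisFun ℂ (Fin N)) w :=
    exteriorPower.basis_apply ℂ d (Pi.basisFun ℂ (Fin N)) w
  rw [h1, h2]
  exact ιMultiDual_map_ιMulti_family _ τ w

theorem minor_one_self (w : Idx N d) : minor 1 w w = 1 := by
  rw [minor, Matrix.submatrix_one _ w.enum.injective, Matrix.det_one]

/-- The value of a polynomial at `M e_w`, for an arbitrary matrix `M`. -/
def evalMinor (w : Idx N d) (M : Matrix (Fin N) (Fin N) ℂ) : PolyRing N d →ₐ[ℂ] ℂ :=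
  MvPolynomial.aeval fun τ => minor M τ w

theorem evalAt_extMap (g : GL (Fin N) ℂ) (w : Idx N d) (f : PolyRing N d) :
    evalAt (extMap d g (extBasis N d w)) f = evalMinor w (g : Matrix (Fin N) (Fin N) ℂ) f := by
  simp only [evalAt, evalMinor, plucker_extMap, MvPolynomial.aeval_eq_eval]

theorem continuous_evalMinor (w : Idx N d) (f : PolyRing N d) :
    Continuous fun M => evalMinor w M f := by
  have : ∀ M, evalMinor w M f = MvPolynomial.eval (fun τ => minor M τ w) f := fun M => by
    simp only [evalMinor, MvPolynomial.aeval_eq_eval]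
  simp only [this]
  refine (MvPolynomial.continuous_eval f).comp (continuous_pi fun τ => ?_)
  exact (continuous_id.matrix_submatrix _ _).matrix_det

theorem evalMinor_X (w τ : Idx N d) (M : Matrix (Fin N) (Fin N) ℂ) :
    evalMinor w M (MvPolynomial.X τ) = minor M τ w := by
  simp [evalMinor]

theorem minor_smul (c : ℂ) (M : Matrix (Fin N) (Fin N) ℂ) (τ w : Idx N d) :
    minor (c • M) τ w = c ^ d * minor M τ w := by
  simp [minor, Matrix.submatrix_smul]

/-! ### The vanishing ideal -/

theorem evalAt_smul_of_isHomogeneous {f : PolyRing N d} {n : ℕ} (hf : f.IsHomogeneous n) (c : ℂ)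
    (v : Ext N d) : evalAt (c • v) f = c ^ n * evalAt v f := by
  simp only [evalAt, MvPolynomial.eval_eq, map_smul, smul_eq_mul, mul_pow, Finset.mul_sum]
  refine Finset.sum_congr rfl fun s hs => ?_
  have hn : ∑ i ∈ s.support, s i = n := by
    have := hf (MvPolynomial.mem_support_iff.1 hs)
    rwa [← Finsupp.degree_apply, Finsupp.degree_eq_weight_one]
  rw [Finset.prod_mul_distrib, Finset.prod_pow_eq_pow_sum, hn]
  ring

theorem orbit_subset_schubert (w : Idx N d) {b : GL (Fin N) ℂ} (hb : b ∈ borel N) :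
    projMap d b (fixedPoint w) ∈ schubert w :=
  fun _ _ _ hS => hS _ ⟨b, hb, rfl⟩

theorem projMap_fixedPoint (w : Idx N d) (b : GL (Fin N) ℂ)
    (h : extMap d b (extBasis N d w) ≠ 0) :
    Projectivization.mk ℂ (extMap d b (extBasis N d w)) h = projMap d b (fixedPoint w) := by
  rw [projMap, fixedPoint, Projectivization.map_mk]

theorem extMap_extBasis_ne_zero (w : Idx N d) (b : GL (Fin N) ℂ) :
    extMap d b (extBasis N d w) ≠ 0 := fun h =>
  (extBasis N d).ne_zero w (extMap_injective b (by rw [h, map_zero]))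

theorem evalMinor_eq_zero_of_mem {w : Idx N d} {f : PolyRing N d} (hf : f ∈ vanishingIdeal w)
    {b : GL (Fin N) ℂ} (hb : b ∈ borel N) :
    evalMinor w (b : Matrix (Fin N) (Fin N) ℂ) f = 0 := by
  rw [← evalAt_extMap]
  exact hf _ (orbit_subset_schubert w hb) _ (extMap_extBasis_ne_zero w b)
    (projMap_fixedPoint w b _)

theorem vanishesAt_orbit_of_isHomogeneous {w : Idx N d} {f : PolyRing N d} {n : ℕ}
    (hf : f.IsHomogeneous n) {b : GL (Fin N) ℂ}
    (h : evalMinor w (b : Matrix (Fin N) (Fin N) ℂ) f = 0) :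
    VanishesAt f (projMap d b (fixedPoint w)) := by
  intro v hv hvx
  rw [← projMap_fixedPoint w b (extMap_extBasis_ne_zero w b), Projectivization.mk_eq_mk_iff'] at hvx
  obtain ⟨c, rfl⟩ := hvx
  rw [evalAt_smul_of_isHomogeneous hf, evalAt_extMap, h, mul_zero]

theorem smul_mem_borel {b : GL (Fin N) ℂ} (hb : b ∈ borel N) {c : ℂ} (hc : c ≠ 0) :
    ∃ b' ∈ borel N, (b' : Matrix (Fin N) (Fin N) ℂ) = c • (b : Matrix (Fin N) (Fin N) ℂ) := by
  refine ⟨Units.mk0 c hc • b, fun i j hij => ?_, rfl⟩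
  change c * (b : Matrix (Fin N) (Fin N) ℂ) i j = 0
  rw [hb i j hij, mul_zero]

/-- Scaling `b` by `c` multiplies the degree `n` component by `(c ^ d) ^ n`. Since `d ≥ 1` and `ℂ`
is algebraically closed, `c ^ d` takes every nonzero value, so a polynomial in one variable with
these components as coefficients has infinitely many roots. -/
theorem evalMinor_homogeneousComponent_eq_zero (hd : 1 ≤ d) {w : Idx N d} {f : PolyRing N d}
    (h : ∀ b ∈ borel N, evalMinor w (b : Matrix (Fin N) (Fin N) ℂ) f = 0)
    {b : GL (Fin N) ℂ} (hb : b ∈ borel N) (n : ℕ) :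
    evalMinor w (b : Matrix (Fin N) (Fin N) ℂ) (MvPolynomial.homogeneousComponent n f) = 0 := by
  set e : ℕ → ℂ := fun n =>
    evalMinor w (b : Matrix (Fin N) (Fin N) ℂ) (MvPolynomial.homogeneousComponent n f) with he
  set q : Polynomial ℂ := ∑ n ∈ Finset.range (f.totalDegree + 1), Polynomial.monomial n (e n) with hq
  have hq0 : q = 0 := by
    refine Polynomial.eq_zero_of_infinite_isRoot _
      (((Set.finite_singleton (0 : ℂ)).infinite_compl).mono fun z hz => ?_)
    obtain ⟨c, rfl⟩ := IsAlgClosed.exists_pow_nat_eq z (show 0 < d by omega)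
    have hc : c ≠ 0 := by
      rintro rfl
      exact hz (by simp [show d ≠ 0 by omega])
    obtain ⟨b', hb', hbb⟩ := smul_mem_borel hb hc
    have h0 := h b' hb'
    rw [← MvPolynomial.sum_homogeneousComponent f, map_sum] at h0
    change Polynomial.eval _ _ = 0
    rw [hq, Polynomial.eval_finsetSum, ← h0]
    refine Finset.sum_congr rfl fun n _ => ?_
    simp only [Polynomial.eval_monomial, he]
    rw [← evalAt_extMap, ← evalAt_extMap, mul_comm,
      ← evalAt_smul_of_isHomogeneous (MvPolynomial.homogeneousComponent_isHomogeneous n f)]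
    simp only [evalAt]
    congr 2
    funext τ
    rw [map_smul, plucker_extMap, plucker_extMap, hbb, minor_smul, smul_eq_mul]
  have h1 := congrArg (fun p => p.coeff n) hq0
  simp only [hq, Polynomial.finsetSum_coeff, Polynomial.coeff_monomial, Polynomial.coeff_zero,
    Finset.sum_ite_eq', Finset.mem_range] at h1
  split_ifs at h1 with hn
  · exact h1
  · rw [MvPolynomial.homogeneousComponent_eq_zero _ _ (by omega), map_zero]

/-- This replaces the projective closure by the affine vectors `b e_w`: closure tests only
homogeneous polynomials, and the homogeneous components of `f` can be tested separately. -/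
theorem mem_vanishingIdeal_iff (hd : 1 ≤ d) {w : Idx N d} {f : PolyRing N d} :
    f ∈ vanishingIdeal w ↔
      ∀ b ∈ borel N, evalMinor w (b : Matrix (Fin N) (Fin N) ℂ) f = 0 := by
  refine ⟨fun hf b hb => evalMinor_eq_zero_of_mem hf hb, fun h => ?_⟩
  rw [← MvPolynomial.sum_homogeneousComponent f]
  refine Ideal.sum_mem _ fun n _ => ?_
  intro x hx
  refine hx n _ (MvPolynomial.homogeneousComponent_isHomogeneous n f) ?_
  rintro y ⟨b, hb, rfl⟩
  exact vanishesAt_orbit_of_isHomogeneous (MvPolynomial.homogeneousComponent_isHomogeneous n f)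
    (evalMinor_homogeneousComponent_eq_zero hd h hb n)

/-! ### The Bruhat order -/

theorem one_mem_borel : (1 : GL (Fin N) ℂ) ∈ borel N := fun i j hij => by
  rw [Units.val_one, Matrix.one_apply_ne (ne_of_gt hij)]

theorem mul_mem_borel {g h : GL (Fin N) ℂ} (hg : g ∈ borel N) (hh : h ∈ borel N) :
    g * h ∈ borel N := fun i j hij => by
  rw [Units.val_mul, Matrix.mul_apply]
  refine Finset.sum_eq_zero fun k _ => ?_
  rcases lt_or_ge k i with hk | hk
  · rw [hg i k hk, zero_mul]
  · rw [hh k j (hij.trans_le hk), mul_zero]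

theorem vanishingIdeal_anti {τ w : Idx N d} (h : τ ≤ w) : vanishingIdeal w ≤ vanishingIdeal τ :=
  fun _ hf x hx => hf x (h hx)

/-- A nonzero term of the determinant matches each row of `τ` with a column of `w` that is at least
as large, because `b` is upper triangular. -/
theorem enum_le_of_minor_ne_zero {b : GL (Fin N) ℂ} (hb : b ∈ borel N) {τ w : Idx N d}
    (h : minor (b : Matrix (Fin N) (Fin N) ℂ) τ w ≠ 0) (i : Fin d) : τ.enum i ≤ w.enum i := by
  rw [minor, Matrix.det_apply] at h
  obtain ⟨σ, -, hσ⟩ := Finset.exists_ne_zero_of_sum_ne_zero h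
  refine enum_le_of_perm σ (fun j => ?_) i
  by_contra! hlt
  refine hσ ?_
  rw [Finset.prod_eq_zero (Finset.mem_univ j), smul_zero]
  exact hb _ _ hlt

theorem enum_le_of_le {τ w : Idx N d} (h : τ ≤ w) (i : Fin d) : τ.enum i ≤ w.enum i := by
  by_contra hi
  have h1 : VanishesAt (MvPolynomial.X τ) (projMap d 1 (fixedPoint τ)) := by
    refine h (orbit_subset_schubert τ one_mem_borel) 1 _ (MvPolynomial.isHomogeneous_X _ _) ?_
    rintro y ⟨b, hb, rfl⟩
    refine vanishesAt_orbit_of_isHomogeneous (MvPolynomial.isHomogeneous_X _ _) ?_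
    rw [evalMinor_X]
    by_contra h0
    exact hi (enum_le_of_minor_ne_zero hb h0 i)
  have h2 := h1 _ (extMap_extBasis_ne_zero τ 1) (projMap_fixedPoint τ 1 _)
  rw [evalAt_extMap, evalMinor_X, Units.val_one, minor_one_self] at h2
  exact one_ne_zero h2

/-- The degeneration: if a polynomial vanishes on `B e_w` then it vanishes on `B e_τ` for every
`τ` that is componentwise at most `w`. -/
theorem evalMinor_eq_zero_of_enum_le {τ w : Idx N d} (h : ∀ i, τ.enum i ≤ w.enum i)
    {f : PolyRing N d} (hf : ∀ b ∈ borel N, evalMinor w (b : Matrix (Fin N) (Fin N) ℂ) f = 0)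
    {b : GL (Fin N) ℂ} (hb : b ∈ borel N) :
    evalMinor τ (b : Matrix (Fin N) (Fin N) ℂ) f = 0 := by
  classical
  obtain ⟨c, hcw, hc⟩ : ∃ c : Fin N → Fin N, (∀ i, c (w.enum i) = τ.enum i) ∧ ∀ j, c j ≤ j := by
    refine ⟨Function.extend w.enum τ.enum id, fun i => w.enum.injective.extend_apply _ _ i,
      fun j => ?_⟩
    by_cases hj : ∃ i, w.enum i = j
    · obtain ⟨i, rfl⟩ := hj
      rw [w.enum.injective.extend_apply]
      exact h i
    · rw [Function.extend_apply' _ _ _ hj]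
      exact le_rfl
  -- `P` sends `e_j` to `e_{c j}`, so it takes `e_w` to `e_τ`. It is upper triangular because `c j ≤
  -- j`, but possibly singular; `P + t • 1` has diagonal entries `t` or `1 + t` and lies in `B` away
  -- from `t = 0, -1`. Continuity then gives the value at `t = 0`.
  let P : Matrix (Fin N) (Fin N) ℂ := Matrix.of fun k j => if k = c j then 1 else 0
  let F : ℂ → ℂ := fun t => evalMinor w ((b : Matrix (Fin N) (Fin N) ℂ) * (P + t • 1)) f
  have hF : Continuous F := by
    refine (continuous_evalMinor w f).comp ?_
    fun_prop
  have hne : ∀ t ∈ ({0, -1} : Set ℂ)ᶜ, F t = 0 := by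
    intro t ht
    simp only [Set.mem_compl_iff, Set.mem_insert_iff, Set.mem_singleton_iff, not_or] at ht
    have hT : (P + t • 1).BlockTriangular id := by
      intro i j hij
      have hij' : j < i := hij
      have h1 : i ≠ c j := ne_of_gt ((hc j).trans_lt hij')
      simp [P, h1, Matrix.one_apply_ne (ne_of_gt hij')]
    have hdet : IsUnit (P + t • 1) := by
      rw [Matrix.isUnit_iff_isUnit_det, Matrix.det_of_isUpperTriangular hT, isUnit_iff_ne_zero,
        Finset.prod_ne_zero_iff]
      intro j _
      simp only [P, Matrix.add_apply, Matrix.of_apply, Matrix.smul_apply, Matrix.one_apply_eq,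
        smul_eq_mul, mul_one]
      split_ifs
      · intro h0
        exact ht.2 (by linear_combination h0)
      · simpa using ht.1
    obtain ⟨u, hu⟩ := hdet
    have hub : u ∈ borel N := fun i j hij => by
      rw [hu]
      exact hT hij
    have := hf (b * u) (mul_mem_borel hb hub)
    rwa [Units.val_mul, hu] at this
  have hz : F 0 = 0 := by
    have hd : Dense ({0, -1} : Set ℂ)ᶜ := (Set.toFinite _).countable.dense_compl ℂ
    exact congrFun (hF.ext_on hd continuous_const hne) 0
  rw [← hz]
  simp only [F, evalMinor, zero_smul, add_zero]
  congr 2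
  funext σ
  simp only [minor]
  congr 1
  ext i j
  simp [P, Matrix.mul_apply, hcw]

theorem le_iff_enum {τ w : Idx N d} : τ ≤ w ↔ ∀ i, τ.enum i ≤ w.enum i := by
  refine ⟨enum_le_of_le, fun h x hx n f hf hw => ?_⟩
  refine hx n f hf ?_
  rintro y ⟨b, hb, rfl⟩
  refine vanishesAt_orbit_of_isHomogeneous hf (evalMinor_eq_zero_of_enum_le h (fun b' hb' => ?_) hb)
  rw [← evalAt_extMap]
  exact hw _ ⟨b', hb', rfl⟩ _ (extMap_extBasis_ne_zero w b') (projMap_fixedPoint w b' _)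

theorem le_iff_cnt {τ w : Idx N d} : τ ≤ w ↔ ∀ m, cnt m w ≤ cnt m τ :=
  ⟨fun h => cnt_le_of_enum_le (le_iff_enum.1 h), fun h => le_iff_enum.2 (enum_le_of_cnt_le h)⟩

theorem le_antisymm_idx {τ w : Idx N d} (h1 : τ ≤ w) (h2 : w ≤ τ) : τ = w :=
  Idx.enum_injective (RelEmbedding.ext fun i =>
    le_antisymm (le_iff_enum.1 h1 i) (le_iff_enum.1 h2 i))

theorem rank_lt_of_le_of_ne {τ w : Idx N d} (h : τ ≤ w) (hne : τ ≠ w) : rank τ < rank w := by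
  rw [le_iff_enum] at h
  rw [rank, rank, wsum_eq_sum_enum, wsum_eq_sum_enum]
  obtain ⟨i, hi⟩ : ∃ i, τ.enum i ≠ w.enum i := by
    by_contra! hc
    exact hne (Idx.enum_injective (RelEmbedding.ext hc))
  refine Finset.sum_lt_sum (fun j _ => ?_) ⟨i, Finset.mem_univ i, ?_⟩
  · exact_mod_cast h j
  · exact_mod_cast lt_of_le_of_ne (h i) hi

theorem X_mem_vanishingIdeal (hd : 1 ≤ d) {τ w : Idx N d} (h : ¬ τ ≤ w) :
    MvPolynomial.X τ ∈ vanishingIdeal w := by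
  rw [mem_vanishingIdeal_iff hd]
  intro b hb
  rw [evalMinor_X]
  by_contra h0
  exact h (le_iff_enum.2 (enum_le_of_minor_ne_zero hb h0))

theorem minor_self_ne_zero (w : Idx N d) {b : GL (Fin N) ℂ} (hb : b ∈ borel N) :
    minor (b : Matrix (Fin N) (Fin N) ℂ) w w ≠ 0 := by
  have hT : (b : Matrix (Fin N) (Fin N) ℂ).BlockTriangular id := fun i j hij => hb i j hij
  have hT' : ((b : Matrix (Fin N) (Fin N) ℂ).submatrix w.enum w.enum).BlockTriangular id :=
    fun i j hij => hb _ _ (w.enum.lt_iff_lt.2 hij)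
  have hdet := (Matrix.isUnit_iff_isUnit_det _).1 b.isUnit
  rw [Matrix.det_of_isUpperTriangular hT, isUnit_iff_ne_zero, Finset.prod_ne_zero_iff] at hdet
  rw [minor, Matrix.det_of_isUpperTriangular hT', Finset.prod_ne_zero_iff]
  exact fun i _ => hdet _ (Finset.mem_univ _)

/-! ### Linear independence of standard monomials -/

/-- The monomial attached to a tuple of indices, in the polynomial ring. -/
def tupleMonomial {r : ℕ} (γ : Fin r → Idx N d) : PolyRing N d := ∏ i, MvPolynomial.X (γ i)

open Classical in
/-- The terms of a linear combination of monomials which survive on `X(τ)`. -/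
theorem sum_restrict_mem_vanishingIdeal (hd : 1 ≤ d) {r : ℕ} {τ w : Idx N d} (h : τ ≤ w)
    {a : (Fin r → Idx N d) → ℂ}
    (ha : ∑ γ, MvPolynomial.C (a γ) * tupleMonomial γ ∈ vanishingIdeal w) :
    ∑ γ, MvPolynomial.C (if ∀ i, γ i ≤ τ then a γ else 0) * tupleMonomial γ ∈
      vanishingIdeal τ := by
  have h1 := vanishingIdeal_anti h ha
  rw [← sub_sub_cancel (∑ γ, MvPolynomial.C (a γ) * tupleMonomial γ) (∑ γ, _)]
  refine Ideal.sub_mem _ h1 ?_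
  rw [← Finset.sum_sub_distrib]
  refine Ideal.sum_mem _ fun γ _ => ?_
  split_ifs with hγ
  · rw [sub_self]
    exact Ideal.zero_mem _
  · push Not at hγ
    obtain ⟨i, hi⟩ := hγ
    rw [map_zero, zero_mul, sub_zero, tupleMonomial]
    exact Ideal.mul_mem_left _ _ (Ideal.mem_of_dvd _ (Finset.dvd_prod_of_mem _ (Finset.mem_univ i))
      (X_mem_vanishingIdeal hd hi))

/-- Induction on the degree and, inside it, on `w`. A term whose first factor is strictly below `w`
dies by restriction to the Schubert variety of that factor. All remaining terms share the factor
`p_w`, which vanishes nowhere on `B e_w` and can be cancelled. -/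
theorem eq_zero_of_sum_mem_vanishingIdeal (hd : 1 ≤ d) (r : ℕ) (w : Idx N d) :
    ∀ a : (Fin r → Idx N d) → ℂ, (∀ γ, a γ ≠ 0 → Antitone γ ∧ ∀ i, γ i ≤ w) →
      ∑ γ, MvPolynomial.C (a γ) * tupleMonomial γ ∈ vanishingIdeal w → a = 0 := by
  classical
  induction r generalizing w with
  | zero =>
    intro a _ ha
    have h1 := evalMinor_eq_zero_of_mem ha one_mem_borel
    funext γ
    rw [Fintype.sum_unique, Subsingleton.elim default γ] at h1
    simpa [tupleMonomial, evalMinor] using h1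
  | succ r ihr =>
    induction w using WellFoundedLT.induction with
    | ind w ihw =>
    intro a hs ha
    have key : ∀ γ, a γ ≠ 0 → γ 0 = w := by
      intro γ hγ
      by_contra hne
      have hle := (hs γ hγ).2 0
      have hlt : γ 0 < w := lt_of_le_not_ge hle fun hge => hne (le_antisymm_idx hle hge)
      have h0 := ihw (γ 0) hlt (fun δ => if ∀ i, δ i ≤ γ 0 then a δ else 0) (fun δ hδ => ?_)
        (sum_restrict_mem_vanishingIdeal hd hle ha)
      · have := congrFun h0 γ
        simp only [Pi.zero_apply] at this
        rw [if_pos fun i => (hs γ hγ).1 (Fin.zero_le i)] at this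
        exact hγ this
      · by_cases hc : ∀ i, δ i ≤ γ 0
        · rw [if_pos hc] at hδ
          exact ⟨(hs δ hδ).1, hc⟩
        · rw [if_neg hc] at hδ
          exact absurd rfl hδ
    set a' : (Fin r → Idx N d) → ℂ := fun γ => a (Fin.cons w γ) with ha'
    have hsum : ∑ γ, MvPolynomial.C (a γ) * tupleMonomial γ =
        MvPolynomial.X w * ∑ γ, MvPolynomial.C (a' γ) * tupleMonomial γ := by
      have hcons : ∀ (τ : Idx N d) (γ : Fin r → Idx N d),
          Fin.consEquiv (fun _ : Fin (r + 1) => Idx N d) (τ, γ) = Fin.cons τ γ := fun _ _ => rfl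
      rw [← (Fin.consEquiv fun _ : Fin (r + 1) => Idx N d).sum_comp, Fintype.sum_prod_type]
      simp only [hcons]
      rw [Finset.sum_eq_single w, Finset.mul_sum]
      · refine Finset.sum_congr rfl fun γ _ => ?_
        simp only [tupleMonomial, Fin.prod_univ_succ, Fin.cons_zero,
          Fin.cons_succ, ha']
        ring
      · intro τ _ hτ
        refine Finset.sum_eq_zero fun γ _ => ?_
        by_cases hz : a (Fin.cons τ γ) = 0
        · simp [hz]
        · exact absurd (key _ hz) (by simpa using hτ)
      · simp
    have hmem : ∑ γ, MvPolynomial.C (a' γ) * tupleMonomial γ ∈ vanishingIdeal w := by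
      rw [mem_vanishingIdeal_iff hd]
      intro b hb
      rw [hsum] at ha
      have h1 := evalMinor_eq_zero_of_mem ha hb
      rw [map_mul, evalMinor_X] at h1
      exact (mul_eq_zero.1 h1).resolve_left (minor_self_ne_zero w hb)
    have h0 := ihr w a' (fun γ hγ => ?_) hmem
    · funext γ
      by_contra hγ
      have hw := key γ hγ
      have := congrFun h0 (Fin.tail γ)
      simp only [ha', ← hw, Fin.cons_self_tail] at this
      exact hγ this
    · obtain ⟨h1, h2⟩ := hs _ hγ
      refine ⟨fun i j hij => ?_, fun i => ?_⟩
      · simpa using h1 (Fin.succ_le_succ_iff.2 hij)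
      · simpa using h2 i.succ

/-! ### Quadratic relations -/

/-- The maximal minor of `M` with the rows `u 0, u 1, …`. -/
def rowMinor (M : Matrix (Fin N) (Fin d) ℂ) (u : Fin d → Fin N) : ℂ := (M.submatrix u id).det

theorem rowMinor_comp_perm (M : Matrix (Fin N) (Fin d) ℂ) (u : Fin d → Fin N)
    (σ : Equiv.Perm (Fin d)) : rowMinor M (u ∘ σ) = (Equiv.Perm.sign σ : ℤ) * rowMinor M u :=
  Matrix.det_permute σ (M.submatrix u id)

theorem rowMinor_eq_zero (M : Matrix (Fin N) (Fin d) ℂ) {u : Fin d → Fin N}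
    (hu : ¬ Function.Injective u) : rowMinor M u = 0 := by
  simp only [Function.Injective, not_forall] at hu
  obtain ⟨i, j, hij, hne⟩ := hu
  refine Matrix.det_zero_of_row_eq hne ?_
  funext k
  simp [hij]

theorem exists_enum_comp_perm {u : Fin d → Fin N} (hu : Function.Injective u) :
    ∃ (τ : Idx N d) (σ : Equiv.Perm (Fin d)), u = τ.enum ∘ σ := by
  let τ : Idx N d := ⟨Finset.univ.image u, by
    change (Finset.univ.image u).card = d
    rw [Finset.card_image_of_injective _ hu, Finset.card_fin]⟩
  have h : ∀ i, ∃ j, τ.enum j = u i := fun i =>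
    (τ.mem_toFinset_iff _).1 (Finset.mem_image_of_mem u (Finset.mem_univ i))
  choose s hs using h
  have hsi : Function.Injective s := fun i j hij => hu (by rw [← hs, hij, hs])
  exact ⟨τ, Equiv.ofBijective s hsi.bijective_of_finite, funext fun i => (hs i).symm⟩

/-- The product of two determinants, as a multilinear map of all the rows. -/
def detMulDet (d : ℕ) : MultilinearMap ℂ (fun _ : Fin d ⊕ Fin d => Fin d → ℂ) ℂ :=
  (LinearMap.mul' ℂ ℂ).compMultilinearMap
    (MultilinearMap.domCoprod (Matrix.detRowAlternating (R := ℂ) (n := Fin d)).toMultilinearMap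
      (Matrix.detRowAlternating (R := ℂ) (n := Fin d)).toMultilinearMap)

theorem detMulDet_apply (x : Fin d ⊕ Fin d → Fin d → ℂ) :
    detMulDet d x = (Matrix.of fun i => x (Sum.inl i)).det * (Matrix.of fun i => x (Sum.inr i)).det :=
  rfl

/-- Antisymmetrizing more than `d` rows gives zero. -/
theorem sum_sign_mul_rowMinor (M : Matrix (Fin N) (Fin d) ℂ) (v : Fin d ⊕ Fin d → Fin N)
    (P : Fin d ⊕ Fin d → Prop) [DecidablePred P] (hP : d < Fintype.card {s // P s}) :
    ∑ σ : Equiv.Perm {s // P s}, ((Equiv.Perm.sign σ : ℤ) : ℂ) *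
      (rowMinor M (v ∘ Equiv.Perm.ofSubtype σ ∘ Sum.inl) *
        rowMinor M (v ∘ Equiv.Perm.ofSubtype σ ∘ Sum.inr)) = 0 := by
  let m : MultilinearMap ℂ (fun _ : {s // P s} => Fin d → ℂ) ℂ :=
    (detMulDet d).domDomRestrict P fun s => M (v s)
  -- More than `d` vectors in `ℂ^d` are dependent, and an alternating map kills dependent families.
  have hli : ¬ LinearIndependent ℂ fun s : {s // P s} => M (v s) := fun h => by
    have := h.fintype_card_le_finrank
    simp at this
    omega
  have h0 := (MultilinearMap.alternatization m).map_linearDependent _ hli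
  rw [MultilinearMap.alternatization_apply] at h0
  rw [← h0]
  refine Finset.sum_congr rfl fun σ _ => ?_
  have hrow : ∀ s, M (v (Equiv.Perm.ofSubtype σ s)) =
      if h : P s then M (v (σ ⟨s, h⟩)) else M (v s) := by
    intro s
    split_ifs with h
    · rw [Equiv.Perm.ofSubtype_apply_of_mem σ h]
    · rw [Equiv.Perm.ofSubtype_apply_of_not_mem σ h]
  have hm : (m.domDomCongr σ) (fun s => M (v s)) =
      rowMinor M (v ∘ Equiv.Perm.ofSubtype σ ∘ Sum.inl) *
        rowMinor M (v ∘ Equiv.Perm.ofSubtype σ ∘ Sum.inr) := by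
    rw [MultilinearMap.domDomCongr_apply, MultilinearMap.domDomRestrict_apply, detMulDet_apply]
    simp only [← hrow]
    rfl
  rw [hm, Units.smul_def, zsmul_eq_mul]

/-- `α, β` have the same elements as `τ, φ`, with multiplicities. -/
def SameContent (α β τ φ : Idx N d) : Prop :=
  ∀ g : Fin N → ℤ, wsum g α + wsum g β = wsum g τ + wsum g φ

/-- The rows that are exchanged at a violation of the order at position `l`. -/
def Exchanged (l : Fin d) : Fin d ⊕ Fin d → Prop := Sum.elim (fun i => l ≤ i) fun i => i ≤ l

theorem card_exchanged (l : Fin d) [DecidablePred (Exchanged l)] :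
    Fintype.card {s // Exchanged l s} = d + 1 := by
  have h : Finset.univ.filter (Exchanged l) = (Finset.Ici l).disjSum (Finset.Iic l) := by
    ext s
    rw [Finset.mem_filter]
    rcases s with s | s <;> simp [Exchanged]
  rw [Fintype.card_subtype, h, Finset.card_disjSum, Fin.card_Ici, Fin.card_Iic]
  omega

/-- The exchanged entries of `φ` are at most `φ.enum l`, those of `τ` at least `τ.enum l`. Bringing
an entry of `φ` to the side of `τ` therefore lowers the sum on that side. -/
theorem sum_exchange_lt {τ φ : Idx N d} {l : Fin d} (hl : φ.enum l < τ.enum l)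
    (σ : Equiv.Perm (Fin d ⊕ Fin d)) (hσ : ∀ s, Exchanged l s ↔ Exchanged l (σ s))
    (hfix : ∀ s, ¬ Exchanged l s → σ s = s) {i₀ j₀ : Fin d} (h₀ : σ (Sum.inl i₀) = Sum.inr j₀) :
    ∑ i, ((Sum.elim τ.enum φ.enum (σ (Sum.inl i))).val : ℤ) < rank τ := by
  classical
  set h : Fin d ⊕ Fin d → ℤ := fun s => ((Sum.elim τ.enum φ.enum s).val : ℤ) with hh
  -- Shifting by the threshold `τ.enum l` makes exchanged entries nonnegative on the left and
  -- negative on the right, so the left sum of `q` is the largest sum that any rearrangement can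
  -- produce.
  set q : Fin d ⊕ Fin d → ℤ := fun s => if Exchanged l s then h s - (τ.enum l).val else 0 with hq
  have hinl : ∀ i, 0 ≤ q (Sum.inl i) := by
    intro i
    simp only [hq, hh, Sum.elim_inl]
    split_ifs with hi
    · have : τ.enum l ≤ τ.enum i := τ.enum.monotone hi
      have : (τ.enum l).val ≤ (τ.enum i).val := this
      omega
    · exact le_rfl
  have hinr : ∀ i, q (Sum.inr i) ≤ 0 := by
    intro i
    simp only [hq, hh, Sum.elim_inr]
    split_ifs with hi
    · have h1 : φ.enum i ≤ φ.enum l := φ.enum.monotone hi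
      have h2 : (φ.enum i).val < (τ.enum l).val := h1.trans_lt hl
      omega
    · exact le_rfl
  have hi₀ : q (Sum.inr j₀) < 0 := by
    have hex : Exchanged l (Sum.inr j₀) := by
      by_contra hc
      have h1 : σ (Sum.inr j₀) = Sum.inr j₀ := hfix _ hc
      have := σ.injective (h₀.trans h1.symm)
      exact absurd this (by simp)
    have h1 : φ.enum j₀ ≤ φ.enum l := φ.enum.monotone hex
    have h2 : (φ.enum j₀).val < (τ.enum l).val := h1.trans_lt hl
    simp only [hq, hh, if_pos hex, Sum.elim_inr]
    omega
  have hdiff : ∀ i, h (σ (Sum.inl i)) - h (Sum.inl i) = q (σ (Sum.inl i)) - q (Sum.inl i) := by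
    intro i
    simp only [hq]
    by_cases hc : Exchanged l (Sum.inl i)
    · rw [if_pos hc, if_pos ((hσ _).1 hc)]
      ring
    · rw [hfix _ hc, sub_self, sub_self]
  have hlt : ∑ i, q (σ (Sum.inl i)) < ∑ i, max (q (σ (Sum.inl i))) 0 := by
    refine Finset.sum_lt_sum (fun i _ => le_max_left _ _) ⟨i₀, Finset.mem_univ _, ?_⟩
    rw [h₀, max_eq_right hi₀.le]
    exact hi₀
  have hle : ∑ i, max (q (σ (Sum.inl i))) 0 ≤ ∑ s, max (q (σ s)) 0 := by
    rw [Fintype.sum_sum_type]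
    exact le_add_of_nonneg_right (Finset.sum_nonneg fun _ _ => le_max_right _ _)
  have heq : ∑ s, max (q (σ s)) 0 = ∑ i, q (Sum.inl i) := by
    rw [Equiv.sum_comp σ fun s => max (q s) 0, Fintype.sum_sum_type]
    rw [Finset.sum_eq_zero (s := Finset.univ) (f := fun i => max (q (Sum.inr i)) 0)
      fun i _ => max_eq_right (hinr i), add_zero]
    exact Finset.sum_congr rfl fun i _ => max_eq_left (hinl i)
  have hfin : ∑ i, (h (σ (Sum.inl i)) - h (Sum.inl i)) < 0 := by
    simp only [hdiff, Finset.sum_sub_distrib]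
    linarith
  rw [Finset.sum_sub_distrib] at hfin
  rw [rank, wsum_eq_sum_enum]
  simp only [hh, Sum.elim_inl] at hfin ⊢
  linarith

/-- In the antisymmetrized sum, permutations preserving the two sides all contribute the original
product, since their signs cancel against those of the determinants. Every other term vanishes
through a repeated row or has a first factor of smaller `rank`. -/
theorem rowMinor_mul_mem_span {τ φ : Idx N d} {l : Fin d} (hl : φ.enum l < τ.enum l) :
    (fun M => rowMinor M τ.enum * rowMinor M φ.enum) ∈ Submodule.span ℂ
      {F : Matrix (Fin N) (Fin d) ℂ → ℂ | ∃ α β : Idx N d, SameContent α β τ φ ∧ rank α < rank τ ∧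
        F = fun M => rowMinor M α.enum * rowMinor M β.enum} := by
  classical
  set S := Submodule.span ℂ
      {F : Matrix (Fin N) (Fin d) ℂ → ℂ | ∃ α β : Idx N d, SameContent α β τ φ ∧ rank α < rank τ ∧
        F = fun M => rowMinor M α.enum * rowMinor M β.enum} with hS
  set v : Fin d ⊕ Fin d → Fin N := Sum.elim τ.enum φ.enum with hv
  set T : Equiv.Perm {s // Exchanged l s} → Matrix (Fin N) (Fin d) ℂ → ℂ := fun σ M =>
    ((Equiv.Perm.sign σ : ℤ) : ℂ) * (rowMinor M (v ∘ Equiv.Perm.ofSubtype σ ∘ Sum.inl) *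
        rowMinor M (v ∘ Equiv.Perm.ofSubtype σ ∘ Sum.inr)) with hT
  set good : Equiv.Perm {s // Exchanged l s} → Prop := fun σ =>
    Set.MapsTo (Equiv.Perm.ofSubtype σ) (Set.range (Sum.inl : Fin d → Fin d ⊕ Fin d))
      (Set.range Sum.inl) with hgood
  have h0 : ∑ σ, T σ = 0 := by
    funext M
    rw [Finset.sum_apply]
    exact sum_sign_mul_rowMinor M v (Exchanged l) (by rw [card_exchanged]; omega)
  have h1 : ∀ σ, good σ → T σ = fun M => rowMinor M τ.enum * rowMinor M φ.enum := by
    intro σ hσ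
    obtain ⟨⟨σ₁, σ₂⟩, hσσ⟩ := Equiv.Perm.mem_sumCongrHom_range_of_perm_mapsTo_inl hσ
    rw [Equiv.Perm.sumCongrHom_apply] at hσσ
    funext M
    have hsign : Equiv.Perm.sign σ = Equiv.Perm.sign σ₁ * Equiv.Perm.sign σ₂ := by
      rw [← Equiv.Perm.sign_ofSubtype, ← hσσ, Equiv.Perm.sign_sumCongr]
    have e1 : v ∘ Equiv.Perm.ofSubtype σ ∘ Sum.inl = τ.enum ∘ σ₁ := by
      funext i; simp [hv, ← hσσ]
    have e2 : v ∘ Equiv.Perm.ofSubtype σ ∘ Sum.inr = φ.enum ∘ σ₂ := by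
      funext i; simp [hv, ← hσσ]
    simp only [hT, e1, e2, hsign, rowMinor_comp_perm]
    rcases Int.units_eq_one_or (Equiv.Perm.sign σ₁) with h | h <;>
      rcases Int.units_eq_one_or (Equiv.Perm.sign σ₂) with h' | h' <;> simp [h, h']
  have h2 : ∀ σ, ¬ good σ → T σ ∈ S := by
    intro σ hσ
    by_cases hu1 : Function.Injective (v ∘ Equiv.Perm.ofSubtype σ ∘ Sum.inl)
    swap
    · have : T σ = 0 := by
        funext M
        simp [hT, rowMinor_eq_zero M hu1]
      rw [this]
      exact S.zero_mem
    by_cases hu2 : Function.Injective (v ∘ Equiv.Perm.ofSubtype σ ∘ Sum.inr)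
    swap
    · have : T σ = 0 := by
        funext M
        simp [hT, rowMinor_eq_zero M hu2]
      rw [this]
      exact S.zero_mem
    obtain ⟨α, π₁, hα⟩ := exists_enum_comp_perm hu1
    obtain ⟨β, π₂, hβ⟩ := exists_enum_comp_perm hu2
    have hw1 : ∀ g : Fin N → ℤ, wsum g α = ∑ i, g (v (Equiv.Perm.ofSubtype σ (Sum.inl i))) := by
      intro g
      rw [wsum_eq_sum_enum, ← Equiv.sum_comp π₁]
      exact Finset.sum_congr rfl fun i _ => congrArg g (congrFun hα i).symm
    have hw2 : ∀ g : Fin N → ℤ, wsum g β = ∑ i, g (v (Equiv.Perm.ofSubtype σ (Sum.inr i))) := by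
      intro g
      rw [wsum_eq_sum_enum, ← Equiv.sum_comp π₂]
      exact Finset.sum_congr rfl fun i _ => congrArg g (congrFun hβ i).symm
    have hTσ : T σ = (((Equiv.Perm.sign σ : ℤ) : ℂ) * ((Equiv.Perm.sign π₁ : ℤ) : ℂ) *
        ((Equiv.Perm.sign π₂ : ℤ) : ℂ)) • fun M => rowMinor M α.enum * rowMinor M β.enum := by
      funext M
      simp only [hT, hα, hβ, rowMinor_comp_perm, Pi.smul_apply, smul_eq_mul]
      ring
    rw [hTσ]
    refine S.smul_mem _ (Submodule.subset_span ⟨α, β, fun g => ?_, ?_, rfl⟩)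
    · rw [hw1, hw2, wsum_eq_sum_enum, wsum_eq_sum_enum,
        ← Fintype.sum_sum_type fun s => g (v (Equiv.Perm.ofSubtype σ s)),
        Equiv.sum_comp (Equiv.Perm.ofSubtype σ) fun s => g (v s), Fintype.sum_sum_type]
      rfl
    · rw [rank, hw1]
      simp only [hgood, Set.MapsTo, Set.forall_mem_range, not_forall] at hσ
      obtain ⟨i₀, hi₀⟩ := hσ
      obtain ⟨j₀, hj₀⟩ : ∃ j₀, Equiv.Perm.ofSubtype σ (Sum.inl i₀) = Sum.inr j₀ := by
        rcases hx : Equiv.Perm.ofSubtype σ (Sum.inl i₀) with k | k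
        · exact absurd ⟨k, hx.symm⟩ hi₀
        · exact ⟨k, rfl⟩
      refine sum_exchange_lt hl (Equiv.Perm.ofSubtype σ) (fun s => ?_) (fun s hs => ?_) hj₀
      · exact (Equiv.Perm.ofSubtype_apply_mem_iff_mem σ s).symm
      · exact Equiv.Perm.ofSubtype_apply_of_not_mem σ hs
  rw [← Finset.sum_filter_add_sum_filter_not _ good, Finset.sum_congr rfl fun σ hσ =>
    h1 σ (Finset.mem_filter.1 hσ).2, Finset.sum_const, ← Nat.cast_smul_eq_nsmul ℂ] at h0
  -- The coefficient of the original product is the number of side-preserving permutations, which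
  -- includes the identity; it is invertible in characteristic zero.
  have hK : ((Finset.univ.filter good).card : ℂ) ≠ 0 := by
    rw [Nat.cast_ne_zero, Finset.card_ne_zero]
    refine ⟨1, Finset.mem_filter.2 ⟨Finset.mem_univ _, fun x hx => ?_⟩⟩
    simpa using hx
  rw [← Submodule.smul_mem_iff S hK, eq_neg_of_add_eq_zero_left h0]
  exact S.neg_mem (Submodule.sum_mem _ fun σ hσ => h2 σ (Finset.mem_filter.1 hσ).2)

/-- Evaluation of a polynomial at the maximal minors of a matrix. -/
def evalRowMinor : PolyRing N d →ₐ[ℂ] (Matrix (Fin N) (Fin d) ℂ → ℂ) :=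
  MvPolynomial.aeval fun τ M => rowMinor M τ.enum

theorem evalRowMinor_X_mul_X (α β : Idx N d) :
    evalRowMinor (MvPolynomial.X α * MvPolynomial.X β) =
      fun M => rowMinor M α.enum * rowMinor M β.enum := by
  funext M
  simp [evalRowMinor]

/-- The coordinates of `b e_w` are the maximal minors of the columns `w` of `b`, so an identity
among maximal minors of all `N × d` matrices holds on every `X(w)`. -/
theorem mem_vanishingIdeal_of_evalRowMinor (hd : 1 ≤ d) (w : Idx N d) {f : PolyRing N d}
    (hf : evalRowMinor f = 0) : f ∈ vanishingIdeal w := by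
  rw [mem_vanishingIdeal_iff hd]
  intro b _
  have : evalMinor w (b : Matrix (Fin N) (Fin N) ℂ) = (Pi.evalAlgHom ℂ _
      ((b : Matrix (Fin N) (Fin N) ℂ).submatrix id w.enum)).comp evalRowMinor := by
    refine MvPolynomial.algHom_ext fun τ => ?_
    rw [evalMinor_X]
    simp [evalRowMinor, minor, rowMinor]
  rw [this, AlgHom.comp_apply, hf, map_zero]

theorem pl_mul_mem_span_of_enum_lt (hd : 1 ≤ d) (w : Idx N d) {τ φ : Idx N d} {l : Fin d}
    (hl : φ.enum l < τ.enum l) :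
    pl w τ * pl w φ ∈ Submodule.span ℂ {F | ∃ α β : Idx N d, SameContent α β τ φ ∧
      rank α < rank τ ∧ F = pl w α * pl w β} := by
  set S : Set (PolyRing N d) := {F | ∃ α β : Idx N d, SameContent α β τ φ ∧
      rank α < rank τ ∧ F = MvPolynomial.X α * MvPolynomial.X β} with hS
  have h1 : evalRowMinor (MvPolynomial.X τ * MvPolynomial.X φ) ∈
      (Submodule.span ℂ S).map (evalRowMinor (N := N) (d := d)).toLinearMap := by
    rw [Submodule.map_span]
    rw [evalRowMinor_X_mul_X]
    refine Submodule.span_mono ?_ (rowMinor_mul_mem_span hl)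
    rintro _ ⟨α, β, hc, hr, rfl⟩
    exact ⟨_, ⟨α, β, hc, hr, rfl⟩, evalRowMinor_X_mul_X α β⟩
  obtain ⟨q, hq, hqe⟩ := h1
  have h2 : pl w τ * pl w φ = Ideal.Quotient.mkₐ ℂ (vanishingIdeal w) q := by
    rw [pl, pl, ← map_mul]
    refine Ideal.Quotient.eq.2 (mem_vanishingIdeal_of_evalRowMinor hd w ?_)
    rw [map_sub, sub_eq_zero]
    exact hqe.symm
  have h3 := Submodule.mem_map_of_mem (f := (Ideal.Quotient.mkₐ ℂ (vanishingIdeal w)).toLinearMap) hq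
  rw [Submodule.map_span] at h3
  rw [h2]
  refine Submodule.span_mono ?_ h3
  rintro _ ⟨_, ⟨α, β, hc, hr, rfl⟩, rfl⟩
  exact ⟨α, β, hc, hr, map_mul (Ideal.Quotient.mkₐ ℂ (vanishingIdeal w)) _ _⟩

/-- Noncomparable Plücker coordinates can be replaced by pairs that are farther apart. -/
theorem pl_mul_mem_span_of_not_le (hd : 1 ≤ d) (w : Idx N d) {τ φ : Idx N d} (h1 : ¬ τ ≤ φ)
    (h2 : ¬ φ ≤ τ) :
    pl w τ * pl w φ ∈ Submodule.span ℂ {F | ∃ α β : Idx N d, (SameContent α β τ φ ∧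
      rank τ ^ 2 + rank φ ^ 2 < rank α ^ 2 + rank β ^ 2) ∧ F = pl w α * pl w β} := by
  wlog hr : rank τ ≤ rank φ generalizing τ φ with H
  · have := H h2 h1 (not_le.1 hr).le
    rw [mul_comm]
    refine Submodule.span_mono ?_ this
    rintro _ ⟨α, β, ⟨hc, hlt⟩, rfl⟩
    refine ⟨α, β, ⟨fun g => ?_, by linarith⟩, rfl⟩
    rw [hc g, add_comm]
  rw [le_iff_enum] at h1
  push Not at h1
  obtain ⟨l, hl⟩ := h1
  refine Submodule.span_mono ?_ (pl_mul_mem_span_of_enum_lt hd w hl)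
  rintro _ ⟨α, β, hc, hlt, rfl⟩
  refine ⟨α, β, ⟨hc, ?_⟩, rfl⟩
  have h3 : rank α + rank β = rank τ + rank φ := hc _
  rw [eq_sub_of_add_eq' h3]
  -- With the sum of the ranks fixed, the sum of squares grows by `2 (rank τ - rank α) (rank φ -
  -- rank α)`.
  nlinarith [mul_pos (sub_pos.2 hlt) (sub_pos.2 (hlt.trans_le hr))]

/-! ### Straightening -/

/-- If every product of two noncomparable generators is a combination of products of pairs with a
larger weight `f`, then every monomial is a combination of monomials supported on chains, with
control by any property `Q` which is preserved by the replacements. -/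
theorem prod_mem_span_chains {R I : Type*} [CommRing R] [Algebra ℂ R] [Finite I] [Preorder I]
    (p : I → R) (f : I → ℤ) (T : I → I → I → I → Prop)
    (h : ∀ τ φ, ¬ τ ≤ φ → ¬ φ ≤ τ → p τ * p φ ∈ Submodule.span ℂ
      {F | ∃ α β, (T τ φ α β ∧ f τ + f φ < f α + f β) ∧ F = p α * p β})
    (Q : Multiset I → Prop)
    (hQ : ∀ τ φ α β M, T τ φ α β → Q (τ ::ₘ φ ::ₘ M) → Q (α ::ₘ β ::ₘ M))
    (M : Multiset I) (hM : Q M) :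
    (M.map p).prod ∈ Submodule.span ℂ {F | ∃ M' : Multiset I, (Q M' ∧ M'.card = M.card ∧
      ∀ a ∈ M', ∀ b ∈ M', a ≤ b ∨ b ≤ a) ∧ F = (M'.map p).prod} := by
  obtain ⟨B, hB⟩ : ∃ B : ℤ, ∀ i, f i ≤ B := by
    obtain ⟨B, hB⟩ := (Set.finite_range f).bddAbove
    exact ⟨B, fun i => hB ⟨i, rfl⟩⟩
  have hbound : ∀ M : Multiset I, (M.map f).sum ≤ M.card * B := by
    intro M
    have := Multiset.sum_le_card_nsmul (M.map f) B (by simpa using fun i _ => hB i)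
    simpa using this
  -- The total weight is bounded by `card * B`, and each replacement raises it while fixing the
  -- cardinality.
  induction hn : (M.card * B - (M.map f).sum).toNat using Nat.strong_induction_on generalizing M with
  | _ n ih =>
  by_cases hc : ∀ a ∈ M, ∀ b ∈ M, a ≤ b ∨ b ≤ a
  · exact Submodule.subset_span ⟨M, ⟨hM, rfl, hc⟩, rfl⟩
  push Not at hc
  obtain ⟨τ, hτ, φ, hφ, h1, h2⟩ := hc
  obtain ⟨M₁, rfl⟩ := Multiset.exists_cons_of_mem hτ
  have hφ' : φ ∈ M₁ := by
    rcases Multiset.mem_cons.1 hφ with rfl | h'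
    · exact absurd le_rfl h1
    · exact h'
  obtain ⟨M₂, rfl⟩ := Multiset.exists_cons_of_mem hφ'
  set S := Submodule.span ℂ {F | ∃ M' : Multiset I,
    (Q M' ∧ M'.card = (τ ::ₘ φ ::ₘ M₂).card ∧ ∀ a ∈ M', ∀ b ∈ M', a ≤ b ∨ b ≤ a) ∧
      F = (M'.map p).prod} with hS
  have key : Submodule.span ℂ
      {F | ∃ α β, (T τ φ α β ∧ f τ + f φ < f α + f β) ∧ F = p α * p β} ≤
        S.comap (LinearMap.mulRight ℂ (M₂.map p).prod) := by
    rw [Submodule.span_le]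
    rintro _ ⟨α, β, ⟨hT, hlt⟩, rfl⟩
    have hb := hbound (α ::ₘ β ::ₘ M₂)
    have := ih _ ?_ (α ::ₘ β ::ₘ M₂) (hQ _ _ _ _ _ hT hM) rfl
    · simpa [hS, mul_assoc] using this
    · rw [← hn]
      simp only [Multiset.map_cons, Multiset.sum_cons, Multiset.card_cons] at hb ⊢
      omega
  have := key (h τ φ h1 h2)
  simpa [mul_assoc] using this

theorem exists_antitone_tuple {r : ℕ} (M : Multiset (Idx N d)) (hr : M.card = r)
    (hM : ∀ a ∈ M, ∀ b ∈ M, a ≤ b ∨ b ≤ a) :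
    ∃ γ : Fin r → Idx N d, Antitone γ ∧ Finset.univ.val.map γ = M := by
  obtain ⟨γ, rfl⟩ : ∃ γ : Fin r → Idx N d, Finset.univ.val.map γ = M := by
    obtain ⟨l, rfl⟩ : ∃ l : List (Idx N d), (l : Multiset (Idx N d)) = M := Quot.exists_rep M
    rw [Multiset.coe_card] at hr
    subst hr
    refine ⟨l.get, ?_⟩
    change Multiset.map l.get ((List.finRange l.length : List _) : Multiset _) = l
    rw [Multiset.map_coe]
    simp
  -- `rank` is strictly monotone for the Bruhat order, so sorting a chain by decreasing `rank` sorts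
  -- it in that order.
  set σ := Tuple.sort fun i : Fin r => -rank (γ i)
  have hmon : Monotone ((fun i : Fin r => -rank (γ i)) ∘ σ) := Tuple.monotone_sort _
  have hmem : ∀ i, γ i ∈ Finset.univ.val.map γ := fun i =>
    Multiset.mem_map_of_mem γ (Finset.mem_univ i)
  refine ⟨γ ∘ σ, fun i j hij => ?_, ?_⟩
  · have h1 : rank (γ (σ j)) ≤ rank (γ (σ i)) := neg_le_neg_iff.1 (hmon hij)
    rcases hM _ (hmem (σ j)) _ (hmem (σ i)) with h | h
    · exact h
    · by_cases he : γ (σ i) = γ (σ j)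
      · exact he.symm.le
      · exact absurd (rank_lt_of_le_of_ne h he) (not_lt.2 h1)
  · rw [← Multiset.map_map, Multiset.map_univ_val_equiv]

theorem exists_coeff_of_mem_span {ι V : Type*} [Fintype ι] [AddCommGroup V] [Module ℂ V] (f : ι → V)
    (Z : ι → Prop) {x : V} (hx : x ∈ Submodule.span ℂ {F | ∃ i, Z i ∧ F = f i}) :
    ∃ a : ι → ℂ, (∀ i, a i ≠ 0 → Z i) ∧ x = ∑ i, a i • f i := by
  classical
  induction hx using Submodule.span_induction with
  | mem x hx =>
    obtain ⟨i, hi, rfl⟩ := hx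
    refine ⟨Pi.single i 1, fun j hj => ?_, ?_⟩
    · by_cases h : j = i
      · rwa [h]
      · exact absurd (Pi.single_eq_of_ne h 1) hj
    · simp [Pi.single_apply, ite_smul]
  | zero => exact ⟨0, fun i hi => absurd rfl hi, by simp⟩
  | add x y _ _ hx hy =>
    obtain ⟨a, ha, rfl⟩ := hx
    obtain ⟨b, hb, rfl⟩ := hy
    refine ⟨a + b, fun i hi => ?_, by simp [add_smul, Finset.sum_add_distrib]⟩
    by_cases h : a i = 0
    · exact hb i fun h' => hi (by simp [h, h'])
    · exact ha i h
  | smul c x _ hx =>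
    obtain ⟨a, ha, rfl⟩ := hx
    refine ⟨c • a, fun i hi => ha i fun h => hi (by simp [h]), by simp [Finset.smul_sum, mul_smul]⟩

/-- The product of the Plücker coordinates in a tuple, in `ℂ[X(w)]`. -/
def plProd {r : ℕ} (w : Idx N d) (γ : Fin r → Idx N d) : CoordRing w := ∏ i, pl w (γ i)

theorem plProd_eq_multiset {r : ℕ} (w : Idx N d) (γ : Fin r → Idx N d) :
    plProd w γ = ((Finset.univ.val.map γ).map (pl w)).prod := by
  rw [Multiset.map_map]
  rfl

theorem mk_sum_tupleMonomial {r : ℕ} (w : Idx N d) (a : (Fin r → Idx N d) → ℂ) :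
    Ideal.Quotient.mk (vanishingIdeal w) (∑ γ, MvPolynomial.C (a γ) * tupleMonomial γ) =
      ∑ γ, a γ • plProd w γ := by
  rw [map_sum]
  refine Finset.sum_congr rfl fun γ _ => ?_
  rw [← MvPolynomial.smul_eq_C_mul, tupleMonomial, plProd]
  change Ideal.Quotient.mkₐ ℂ (vanishingIdeal w) _ = _
  rw [map_smul, map_prod]
  rfl

theorem pl_eq_zero (hd : 1 ≤ d) {τ w : Idx N d} (h : ¬ τ ≤ w) : pl w τ = 0 :=
  Ideal.Quotient.eq_zero_iff_mem.2 (X_mem_vanishingIdeal hd h)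

theorem eq_zero_of_sum_plProd_eq_zero (hd : 1 ≤ d) {r : ℕ} {w : Idx N d}
    {a : (Fin r → Idx N d) → ℂ} (ha : ∀ γ, a γ ≠ 0 → Antitone γ ∧ ∀ i, γ i ≤ w)
    (h : ∑ γ, a γ • plProd w γ = 0) : a = 0 := by
  rw [← mk_sum_tupleMonomial] at h
  exact eq_zero_of_sum_mem_vanishingIdeal hd r w a ha (Ideal.Quotient.eq_zero_iff_mem.1 h)

/-- The relation `T` and invariant `Q` are left free because straightening is run twice: with the
raw exchange relations, then with the relations that also bound the first factor. -/
theorem exists_standard_expansion (hd : 1 ≤ d) (w : Idx N d) (f : Idx N d → ℤ)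
    (T : Idx N d → Idx N d → Idx N d → Idx N d → Prop)
    (h : ∀ τ φ, ¬ τ ≤ φ → ¬ φ ≤ τ → pl w τ * pl w φ ∈ Submodule.span ℂ
      {F | ∃ α β, (T τ φ α β ∧ f τ + f φ < f α + f β) ∧ F = pl w α * pl w β})
    (Q : Multiset (Idx N d) → Prop)
    (hQ : ∀ τ φ α β M, T τ φ α β → Q (τ ::ₘ φ ::ₘ M) → Q (α ::ₘ β ::ₘ M))
    {r : ℕ} (τ : Fin r → Idx N d) (hτ : Q (Finset.univ.val.map τ)) :
    ∃ a : (Fin r → Idx N d) → ℂ, (∀ γ, a γ ≠ 0 → (Antitone γ ∧ ∀ i, γ i ≤ w) ∧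
      Q (Finset.univ.val.map γ)) ∧ plProd w τ = ∑ γ, a γ • plProd w γ := by
  refine exists_coeff_of_mem_span _ _ ?_
  rw [plProd_eq_multiset]
  refine Submodule.span_le.2 ?_ (prod_mem_span_chains (pl w) f T h Q hQ _ hτ)
  rintro _ ⟨M, ⟨hM, hcard, hc⟩, rfl⟩
  by_cases hw : ∀ a ∈ M, a ≤ w
  · obtain ⟨γ, hγ, rfl⟩ := exists_antitone_tuple (r := r) M (by simpa using hcard) hc
    refine Submodule.subset_span ⟨γ, ⟨⟨hγ, fun i => hw _ ?_⟩, hM⟩, (plProd_eq_multiset w γ).symm⟩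
    exact Multiset.mem_map_of_mem γ (Finset.mem_univ i)
  · push Not at hw
    obtain ⟨a, ha, haw⟩ := hw
    have : (M.map (pl w)).prod = 0 :=
      Multiset.prod_eq_zero (Multiset.mem_map.2 ⟨a, ha, pl_eq_zero hd haw⟩)
    rw [this]
    exact Submodule.zero_mem _

/-- In the standard expansion of the product of two noncomparable Plücker coordinates, the larger
factor of every term is an upper bound. -/
theorem pl_mul_mem_span_bounds (hd : 1 ≤ d) (w : Idx N d) {τ φ : Idx N d} (h1 : ¬ τ ≤ φ)
    (h2 : ¬ φ ≤ τ) :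
    pl w τ * pl w φ ∈ Submodule.span ℂ {F | ∃ α β : Idx N d,
      ((τ ≤ α ∧ φ ≤ α ∧ SameContent α β τ φ) ∧
        rank τ ^ 2 + rank φ ^ 2 < rank α ^ 2 + rank β ^ 2) ∧ F = pl w α * pl w β} := by
  obtain ⟨a, ha, hsum⟩ := exists_standard_expansion hd w (fun τ => rank τ ^ 2)
    (fun τ φ α β => SameContent α β τ φ) (fun τ φ => pl_mul_mem_span_of_not_le hd w)
    (fun M => ∀ g : Fin N → ℤ, (M.map (wsum g)).sum = wsum g τ + wsum g φ)
    (fun τ' φ' α β M hc h g => by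
      have := hc g
      have h' := h g
      simp only [Multiset.map_cons, Multiset.sum_cons] at h' ⊢
      linarith) ![τ, φ] (fun g => by
        rw [Multiset.map_map]
        change ∑ i : Fin 2, _ = _
        simp)
  have hprod : ∀ γ : Fin 2 → Idx N d, plProd w γ = pl w (γ 0) * pl w (γ 1) := fun γ => by
    simp [plProd]
  -- If `τ` or `φ` is not below `γ 0`, the product vanishes on `X(γ 0)`, whereas the surviving
  -- standard monomials, among them that of `γ`, stay independent there.
  have hupper : ∀ γ, a γ ≠ 0 → ∀ ψ, (ψ = τ ∨ ψ = φ) → ψ ≤ γ 0 := by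
    classical
    intro γ hγ ψ hψ
    by_contra hle
    have hγw := (ha γ hγ).1
    have hmem : ∑ γ, MvPolynomial.C (a γ) * tupleMonomial γ ∈ vanishingIdeal (γ 0) := by
      have hx : MvPolynomial.X τ * MvPolynomial.X φ ∈ vanishingIdeal (γ 0) := by
        rcases hψ with rfl | rfl
        · exact Ideal.mul_mem_right _ _ (X_mem_vanishingIdeal hd hle)
        · exact Ideal.mul_mem_left _ _ (X_mem_vanishingIdeal hd hle)
      rw [← mk_sum_tupleMonomial, hprod] at hsum
      have hsub := vanishingIdeal_anti (hγw.2 0) (Ideal.Quotient.eq.1 hsum.symm)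
      exact (Submodule.sub_mem_iff_left _ hx).1 hsub
    have h0 := eq_zero_of_sum_mem_vanishingIdeal hd 2 (γ 0) _ (fun δ hδ => ?_)
      (sum_restrict_mem_vanishingIdeal hd le_rfl hmem)
    · have := congrFun h0 γ
      simp only [Pi.zero_apply] at this
      rw [if_pos fun i => hγw.1 (Fin.zero_le i)] at this
      exact hγ this
    · by_cases hc : ∀ i, δ i ≤ γ 0
      · rw [if_pos hc] at hδ
        exact ⟨(ha δ hδ).1.1, hc⟩
      · rw [if_neg hc] at hδ
        exact absurd rfl hδ
  have hl : pl w τ * pl w φ = plProd w ![τ, φ] := by simp [hprod]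
  rw [hl, hsum]
  refine Submodule.sum_mem _ fun γ _ => ?_
  by_cases hγ : a γ = 0
  · rw [hγ, zero_smul]
    exact Submodule.zero_mem _
  have hτ := hupper γ hγ τ (Or.inl rfl)
  have hφ := hupper γ hγ φ (Or.inr rfl)
  have hcont : SameContent (γ 0) (γ 1) τ φ := fun g => by
    rw [← (ha γ hγ).2 g, Multiset.map_map]
    change _ = ∑ i : Fin 2, _
    simp
  refine Submodule.smul_mem _ _ (Submodule.subset_span
    ⟨γ 0, γ 1, ⟨⟨hτ, hφ, hcont⟩, ?_⟩, hprod γ⟩)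
  have hrτ := rank_lt_of_le_of_ne hτ (by rintro rfl; exact h2 hφ)
  have hrφ := rank_lt_of_le_of_ne hφ (by rintro rfl; exact h1 hτ)
  have h3 : rank (γ 0) + rank (γ 1) = rank τ + rank φ := hcont _
  rw [eq_sub_of_add_eq' h3]
  nlinarith [mul_pos (sub_pos.2 hrτ) (sub_pos.2 hrφ)]

/-- Each replacement keeps the sum of two counts and makes one of them at most both old ones, so the
sum of any convex function of the counts does not decrease. The functions `max (c - x) 0` suffice.
-/
theorem exists_standard_expansion_majorized (hd : 1 ≤ d) (w : Idx N d) {r : ℕ}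
    (τ : Fin r → Idx N d) :
    ∃ a : (Fin r → Idx N d) → ℂ, (∀ γ, a γ ≠ 0 → (Antitone γ ∧ ∀ i, γ i ≤ w) ∧
      ∀ (m : ℕ) (c : ℤ), ∑ i, max (c - cnt m (τ i)) 0 ≤ ∑ i, max (c - cnt m (γ i)) 0) ∧
        plProd w τ = ∑ γ, a γ • plProd w γ := by
  obtain ⟨a, ha, hsum⟩ := exists_standard_expansion hd w (fun τ => rank τ ^ 2)
    (fun τ φ α β => τ ≤ α ∧ φ ≤ α ∧ SameContent α β τ φ)
    (fun τ φ => pl_mul_mem_span_bounds hd w)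
    (fun M => ∀ (m : ℕ) (c : ℤ), ∑ i, max (c - cnt m (τ i)) 0 ≤
      (M.map fun x => max (c - cnt m x) 0).sum)
    (fun τ' φ' α β M hT h m c => by
      have h' := h m c
      have h1 := le_iff_cnt.1 hT.1 m
      have h2 := le_iff_cnt.1 hT.2.1 m
      have h3 : cnt m α + cnt m β = cnt m τ' + cnt m φ' := hT.2.2 _
      simp only [Multiset.map_cons, Multiset.sum_cons] at h' ⊢
      omega) τ (fun m c => by
        rw [Multiset.map_map]
        rfl)
  refine ⟨a, fun γ hγ => ⟨(ha γ hγ).1, fun m c => ?_⟩, hsum⟩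
  have := (ha γ hγ).2 m c
  rwa [Multiset.map_map] at this

/-- The partial sums of the counting functions decrease under straightening. -/
theorem sum_cnt_le_of_majorized {r : ℕ} {τ γ : Fin r → Idx N d} (hγ : Antitone γ) (m : ℕ)
    (h : ∀ c : ℤ, ∑ i, max (c - cnt m (τ i)) 0 ≤ ∑ i, max (c - cnt m (γ i)) 0) (q : Fin r) :
    ∑ i ∈ Finset.Iic q, cnt m (γ i) ≤ ∑ i ∈ Finset.Iic q, cnt m (τ i) := by
  -- For antitone `γ` the counts increase along the tuple, so with this threshold exactly the terms
  -- up to `q` are retained for `γ`; for `τ` the same terms give a lower bound.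
  set c := cnt m (γ q) with hc
  have h1 : ∑ i, max (c - cnt m (γ i)) 0 = ∑ i ∈ Finset.Iic q, (c - cnt m (γ i)) := by
    rw [← Finset.sum_subset (Finset.subset_univ (Finset.Iic q))]
    · refine Finset.sum_congr rfl fun i hi => max_eq_left ?_
      exact sub_nonneg.2 (le_iff_cnt.1 (hγ (Finset.mem_Iic.1 hi)) m)
    · intro i _ hi
      rw [Finset.mem_Iic, not_le] at hi
      exact max_eq_right (sub_nonpos.2 (le_iff_cnt.1 (hγ hi.le) m))
  have h2 : ∑ i ∈ Finset.Iic q, (c - cnt m (τ i)) ≤ ∑ i, max (c - cnt m (τ i)) 0 :=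
    (Finset.sum_le_sum fun i _ => le_max_left _ _).trans
      (Finset.sum_le_sum_of_subset_of_nonneg (Finset.subset_univ _) fun _ _ _ => le_max_right _ _)
  have h3 := (h2.trans (h c)).trans_eq h1
  simp only [Finset.sum_sub_distrib] at h3
  linarith

/-! ### Blocks and simple transpositions -/

theorem block_lt_of_notMem {A : Finset ℕ} {m : ℕ} (hm : m ∉ A) {x y : Fin N} (hx : x.val < m)
    (hy : m ≤ y.val) : block A x < block A y := by
  apply Finset.card_lt_card
  rw [Finset.ssubset_iff_of_subset]
  · refine ⟨m, Finset.mem_filter.2 ⟨Finset.mem_sdiff.2 ⟨Finset.mem_Icc.2 ⟨?_, ?_⟩, hm⟩, hy⟩,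
      fun h => ?_⟩
    · omega
    · omega
    · have := (Finset.mem_filter.mp h).2
      omega
  · intro a ha
    rw [Finset.mem_filter] at ha ⊢
    exact ⟨ha.1, by omega⟩

theorem block_mono (A : Finset ℕ) {x y : Fin N} (h : x ≤ y) : block A x ≤ block A y := by
  refine Finset.card_le_card fun a ha => ?_
  rw [Finset.mem_filter] at ha ⊢
  exact ⟨ha.1, ha.2.trans h⟩

theorem block_eq_of_mem {A : Finset ℕ} {x y : Fin N} (hxy : y.val = x.val + 1) (hy : y.val ∈ A) :
    block A x = block A y := by
  unfold block
  congr 1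
  refine Finset.filter_congr fun a ha => ?_
  have : a ≠ y.val := by
    rintro rfl
    exact (Finset.mem_sdiff.1 ha).2 hy
  omega

theorem cnt_succ {m : ℕ} (hm : m < N) (τ : Idx N d) :
    cnt (m + 1) τ = cnt m τ + if (⟨m, hm⟩ : Fin N) ∈ τ.toFinset then 1 else 0 := by
  rw [← Finset.sum_ite_eq' τ.toFinset (⟨m, hm⟩ : Fin N) fun _ => (1 : ℤ), cnt, cnt, wsum, wsum,
    ← Finset.sum_add_distrib]
  refine Finset.sum_congr rfl fun i _ => ?_
  simp only [Fin.ext_iff]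
  split_ifs <;> omega

theorem cnt_of_le {m : ℕ} (hm : N ≤ m) (τ : Idx N d) : cnt m τ = d := by
  rw [cnt_eq_card_filter, Finset.filter_true_of_mem fun i _ => i.2.trans_le hm, τ.card_toFinset]

theorem simpleRefl_lt_iff {m m' : ℕ} (hm : m ≠ m') (x : Fin N) :
    (simpleRefl N m x).val < m' ↔ x.val < m' := by
  unfold simpleRefl
  split_ifs with h
  · rw [Equiv.swap_apply_def]
    split_ifs with h1 h2
    · subst h1
      simp only
      omega
    · subst h2
      simp only
      omega
    · rfl
  · rfl

theorem cnt_eq_of_simpleRefl {m m' : ℕ} (hm : m ≠ m') {τ φ : Idx N d}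
    (h : τ.toFinset = φ.toFinset.map (simpleRefl N m).toEmbedding) : cnt m' τ = cnt m' φ := by
  rw [cnt, cnt, wsum, wsum, h, Finset.sum_map]
  refine Finset.sum_congr rfl fun i _ => ?_
  simp only [Equiv.coe_toEmbedding, simpleRefl_lt_iff hm]

/-- The image of an index under a permutation. -/
def permIdx (σ : Equiv.Perm (Fin N)) (τ : Idx N d) : Idx N d :=
  ⟨τ.toFinset.map σ.toEmbedding, (Finset.card_map _).trans τ.card_toFinset⟩

theorem permIdx_toFinset (σ : Equiv.Perm (Fin N)) (τ : Idx N d) :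
    (permIdx σ τ).toFinset = τ.toFinset.map σ.toEmbedding := rfl

theorem simpleRefl_simpleRefl (m : ℕ) (x : Fin N) : simpleRefl N m (simpleRefl N m x) = x := by
  unfold simpleRefl
  split_ifs
  · exact Equiv.swap_apply_self _ _ _
  · rfl

theorem minor_permIdx_ne_zero (σ : Equiv.Perm (Fin N)) (τ : Idx N d) :
    minor (Matrix.of fun i j => if i = σ j then 1 else 0) (permIdx σ τ) τ ≠ 0 := by
  obtain ⟨α, π, hα⟩ := exists_enum_comp_perm (σ.injective.comp τ.enum.injective)
  have hα' : α = permIdx σ τ := by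
    apply Idx.ext_toFinset
    ext x
    rw [α.mem_toFinset_iff, permIdx_toFinset, Finset.mem_map]
    constructor
    · rintro ⟨i, rfl⟩
      refine ⟨τ.enum (π.symm i), τ.enum_mem _, ?_⟩
      have := congrFun hα (π.symm i)
      simpa using this
    · rintro ⟨y, hy, rfl⟩
      obtain ⟨i, rfl⟩ := (τ.mem_toFinset_iff y).1 hy
      exact ⟨π i, (congrFun hα i).symm⟩
  have h1 := Matrix.det_permute π ((Matrix.of fun i j => if i = σ j then (1 : ℂ) else 0).submatrix
    α.enum τ.enum)
  intro h0
  rw [minor, ← hα'] at h0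
  rw [h0, mul_zero, Matrix.submatrix_submatrix, ← hα] at h1
  refine one_ne_zero (α := ℂ) ?_
  rw [← h1, ← Matrix.det_one (n := Fin d) (R := ℂ)]
  congr 1
  ext i j
  simp [Matrix.one_apply]

/-- The permutation matrix of `s_m` with `m ∈ A` lies in `P_A`, hence preserves `X(w)`. It moves
`[e_τ]` to a point where the coordinate of `s_m τ` is nonzero, and that coordinate would vanish on
`X(w)` if `s_m τ` were not below `w`. -/
theorem permIdx_simpleRefl_le {A : Finset ℕ} {w τ : Idx N d} (hd : 1 ≤ d)
    (hQ : parabolic N A ≤ stabilizer w) {m : ℕ} (hm : m ∈ A) (hτ : τ ≤ w) :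
    permIdx (simpleRefl N m) τ ≤ w := by
  set M : Matrix (Fin N) (Fin N) ℂ :=
    Matrix.of fun i j => if i = simpleRefl N m j then 1 else 0 with hM
  have hMM : M * M = 1 := by
    ext i j
    rw [Matrix.mul_apply, Finset.sum_eq_single (simpleRefl N m j)]
    · simp [hM, simpleRefl_simpleRefl, Matrix.one_apply]
    · intro k _ hk
      simp [hM, hk]
    · simp
  set g : GL (Fin N) ℂ := ⟨M, M, hMM, hMM⟩ with hg
  have hgp : g ∈ parabolic N A := by
    simp only [parabolic, Subgroup.mem_iInf]
    intro m' hm' i j hj hi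
    have hne : m ≠ m' := by
      rintro rfl
      exact (Finset.mem_sdiff.1 hm').2 hm
    have hij : i ≠ simpleRefl N m j := by
      rintro rfl
      have := (simpleRefl_lt_iff hne j).2 hj
      omega
    change M i j = 0
    simp [hM, hij]
  have himage : projMap d g '' schubert w = schubert w := hQ hgp
  have hmem : projMap d g (fixedPoint τ) ∈ schubert w := by
    rw [← himage]
    refine Set.mem_image_of_mem _ (hτ ?_)
    have := orbit_subset_schubert τ one_mem_borel
    rwa [projMap_one] at this
  by_contra hle
  have h0 := X_mem_vanishingIdeal hd hle _ hmem _ (extMap_extBasis_ne_zero τ g)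
    (projMap_fixedPoint τ g _)
  rw [evalAt_extMap, evalMinor_X] at h0
  exact minor_permIdx_ne_zero _ τ h0

/-! ### Heads -/

/-- In each block a head occupies a final segment: its count is constant and then grows by one at
each step. No other index with boundary counts at least as large can fall below it. -/
theorem cnt_le_of_isHead {A : Finset ℕ} (h0A : 0 ∉ A) (hNA : ∀ m, N ≤ m → m ∉ A) {θ φ : Idx N d}
    (hθ : IsHead A θ) (h : ∀ m, m ∉ A → cnt m θ ≤ cnt m φ) (m : ℕ) : cnt m θ ≤ cnt m φ := by
  -- Inside the final segment, descend from the next boundary: the count of `θ` drops by one at each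
  -- step, that of `φ` by at most one.
  have up : ∀ k m (hm : m < N), N - m = k → (⟨m, hm⟩ : Fin N) ∈ θ.toFinset →
      cnt (m + 1) θ ≤ cnt (m + 1) φ := by
    intro k
    induction k with
    | zero => intro m hm hk; omega
    | succ k ih =>
      intro m hm hk hmem
      by_cases hA : m + 1 ∈ A
      · have hlt : m + 1 < N := by
          by_contra hc
          exact hNA _ (not_lt.1 hc) hA
        have hmem' : (⟨m + 1, hlt⟩ : Fin N) ∈ θ.toFinset := by
          by_contra hc
          have hb : block A (⟨m, hm⟩ : Fin N) = block A (⟨m + 1, hlt⟩ : Fin N) :=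
            block_eq_of_mem rfl hA
          have := hθ _ hmem _ hc hb
          rw [Fin.lt_def] at this
          simp only at this
          omega
        have h1 := ih (m + 1) hlt (by omega) hmem'
        rw [cnt_succ hlt, cnt_succ hlt, if_pos hmem'] at h1
        split_ifs at h1 <;> omega
      · exact h _ hA
  -- Before the final segment, ascend from the previous boundary: the count of `θ` stays constant.
  have down : ∀ m (hm : m < N), (⟨m, hm⟩ : Fin N) ∉ θ.toFinset →
      cnt (m + 1) θ ≤ cnt (m + 1) φ := by
    intro m
    induction m with
    | zero =>
      intro hm hmem
      have := h 0 h0A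
      rw [cnt_succ hm, cnt_succ hm, if_neg hmem]
      split_ifs <;> omega
    | succ m ih =>
      intro hm hmem
      have h1 : cnt (m + 1) θ ≤ cnt (m + 1) φ := by
        by_cases hA : m + 1 ∈ A
        · refine ih (by omega) fun hc => ?_
          have hb : block A (⟨m, by omega⟩ : Fin N) = block A (⟨m + 1, hm⟩ : Fin N) :=
            block_eq_of_mem rfl hA
          have := hθ _ hc _ hmem hb
          rw [Fin.lt_def] at this
          simp only at this
          omega
        · exact h _ hA
      rw [cnt_succ hm, cnt_succ hm, if_neg hmem]
      split_ifs <;> omega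
  rcases m with _ | m
  · exact h 0 h0A
  · by_cases hm : m < N
    · by_cases hmem : (⟨m, hm⟩ : Fin N) ∈ θ.toFinset
      · exact up _ m hm rfl hmem
      · exact down m hm hmem
    · rw [cnt_of_le (by omega), cnt_of_le (by omega)]

/-- Between an element of `τ` and a larger missing element of the same block, membership must stop
at some consecutive pair; both lie in that block, so the label is in `A`. -/
theorem exists_ascent_of_not_isHead {A : Finset ℕ} {τ : Idx N d} (h : ¬ IsHead A τ) :
    ∃ (k : ℕ) (hk : k + 1 < N), k + 1 ∈ A ∧ (⟨k, by omega⟩ : Fin N) ∈ τ.toFinset ∧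
      (⟨k + 1, hk⟩ : Fin N) ∉ τ.toFinset := by
  simp only [IsHead, not_forall, not_lt] at h
  obtain ⟨x, hx, y, hy, hb, hxy⟩ := h
  by_contra! hc
  have key : ∀ (k : ℕ) (hk : k < N), x.val ≤ k → k ≤ y.val → (⟨k, hk⟩ : Fin N) ∈ τ.toFinset := by
    intro k
    induction k with
    | zero =>
      intro hk h1 _
      rwa [show (⟨0, hk⟩ : Fin N) = x from Fin.ext (by simp only; omega)]
    | succ k ih =>
      intro hk h1 h2
      rcases h1.lt_or_eq with h1 | h1
      · refine hc k hk ?_ (ih (by omega) (by omega) (by omega))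
        by_contra hA
        have h3 := block_lt_of_notMem hA (x := x) (y := (⟨k + 1, hk⟩ : Fin N)) h1 le_rfl
        have h4 := block_mono A (x := (⟨k + 1, hk⟩ : Fin N)) (y := y) h2
        omega
      · rwa [show (⟨k + 1, hk⟩ : Fin N) = x from Fin.ext h1.symm]
  exact hy (key y.val y.2 hxy le_rfl)

theorem cnt_permIdx_of_ascent {k : ℕ} (hk : k + 1 < N) {τ : Idx N d}
    (h1 : (⟨k, by omega⟩ : Fin N) ∈ τ.toFinset) (h2 : (⟨k + 1, hk⟩ : Fin N) ∉ τ.toFinset) :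
    cnt (k + 1) (permIdx (simpleRefl N (k + 1)) τ) = cnt (k + 1) τ - 1 := by
  have hk' : k < N := by omega
  have hmem : (⟨k, hk'⟩ : Fin N) ∉ (permIdx (simpleRefl N (k + 1)) τ).toFinset := by
    rw [permIdx_toFinset, Finset.mem_map]
    rintro ⟨x, hx, hxk⟩
    have : x = ⟨k + 1, hk⟩ := by
      rw [← simpleRefl_simpleRefl (k + 1) x]
      rw [Equiv.coe_toEmbedding] at hxk
      rw [hxk]
      simp only [simpleRefl, dif_pos hk, Nat.add_sub_cancel]
      exact Equiv.swap_apply_left _ _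
    exact h2 (this ▸ hx)
  rw [cnt_succ hk', cnt_succ hk', if_neg hmem, if_pos h1,
    cnt_eq_of_simpleRefl (m := k + 1) (m' := k) (by omega) (permIdx_toFinset _ τ)]
  ring

/-- While `τ` is not a head, a transposition with label in `A` moves it up within the finite set
`H_w`. -/
theorem exists_isHeadOf {A : Finset ℕ} {w : Idx N d} (hd : 1 ≤ d)
    (hQ : parabolic N A ≤ stabilizer w) (τ : H w) : ∃ θ, IsHeadOf A w τ θ := by
  induction τ using WellFoundedGT.induction with
  | ind τ ih =>
  by_cases hτ : IsHead A τ.1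
  · exact ⟨τ, hτ, SimpleGraph.Reachable.refl _⟩
  obtain ⟨k, hk, hA, h1, h2⟩ := exists_ascent_of_not_isHead hτ
  let φ : H w := ⟨permIdx (simpleRefl N (k + 1)) τ.1, permIdx_simpleRefl_le hd hQ hA τ.2⟩
  have hcnt : ∀ m, m ≠ k + 1 → cnt m φ.1 = cnt m τ.1 := fun m hm =>
    cnt_eq_of_simpleRefl hm.symm (permIdx_toFinset _ τ.1)
  have hcnt' : cnt (k + 1) φ.1 = cnt (k + 1) τ.1 - 1 := cnt_permIdx_of_ascent hk h1 h2
  have hle : τ ≤ φ := by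
    refine le_iff_cnt.2 fun m => ?_
    by_cases hm : m = k + 1
    · subst hm
      omega
    · exact (hcnt m hm).le
  have hnle : ¬ φ ≤ τ := fun hc => by
    have := le_iff_cnt.1 hc (k + 1)
    omega
  have hlt : τ < φ := lt_of_le_not_ge hle hnle
  -- The counts of `τ` and `φ` differ only at `k + 1`, and there by one, so any index in between has
  -- the counts of one of them.
  have hcov : τ ⋖ φ := by
    refine ⟨hlt, fun ψ hψ1 hψ2 => ?_⟩
    have e1 := le_iff_cnt.1 (show τ.1 ≤ ψ.1 from hψ1.le)
    have e2 := le_iff_cnt.1 (show ψ.1 ≤ φ.1 from hψ2.le)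
    by_cases hc : cnt (k + 1) ψ.1 = cnt (k + 1) φ.1
    · refine (lt_iff_le_not_ge.1 hψ2).2 (le_iff_cnt.2 fun m => ?_)
      by_cases hm : m = k + 1
      · rw [hm, hc]
      · rw [hcnt m hm]
        exact e1 m
    · refine (lt_iff_le_not_ge.1 hψ1).2 (le_iff_cnt.2 fun m => ?_)
      by_cases hm : m = k + 1
      · have := e1 (k + 1)
        have := e2 (k + 1)
        subst hm
        omega
      · rw [← hcnt m hm]
        exact e2 m
  have hadj : (hasse A w).Adj τ φ := by
    refine (SimpleGraph.fromRel_adj _ _ _).2 ⟨hlt.ne, Or.inl ⟨hcov, k + 1, hA, ?_⟩⟩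
    change τ.1.toFinset = (τ.1.toFinset.map _).map _
    rw [Finset.map_map]
    convert Finset.map_refl.symm
    ext x
    simp [simpleRefl_simpleRefl]
  obtain ⟨θ, hθ, hr⟩ := ih φ hlt
  exact ⟨θ, hθ, hadj.reachable.trans hr⟩

theorem cnt_eq_of_reachable {A : Finset ℕ} {w : Idx N d} {τ φ : H w}
    (h : (hasse A w).Reachable τ φ) {m : ℕ} (hm : m ∉ A) : cnt m τ.1 = cnt m φ.1 := by
  obtain ⟨p⟩ := h
  induction p with
  | nil => rfl
  | cons hadj _ ih =>
    rw [← ih]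
    have hne : ∀ m' ∈ A, m' ≠ m := by
      rintro m' hm' rfl
      exact hm hm'
    rcases ((SimpleGraph.fromRel_adj _ _ _).1 hadj).2 with ⟨-, m', hm', h⟩ | ⟨-, m', hm', h⟩
    · exact cnt_eq_of_simpleRefl (hne m' hm') h
    · exact (cnt_eq_of_simpleRefl (hne m' hm') h).symm

/-- The setting of the theorem: `P_A` stabilizes `X(w)`. -/
structure IsAdmissible (A : Finset ℕ) (w : Idx N d) : Prop where
  one_le : 1 ≤ d
  subset : A ⊆ Finset.Icc 1 (N - 1)
  parabolic_le : parabolic N A ≤ stabilizer w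

namespace IsAdmissible

variable {A : Finset ℕ} {w : Idx N d}

theorem le_of_isHead (hA : IsAdmissible A w) {θ φ : Idx N d} (hθ : IsHead A θ)
    (h : ∀ m, m ∉ A → cnt m θ ≤ cnt m φ) : φ ≤ θ := by
  refine le_iff_cnt.2 (cnt_le_of_isHead (fun h0 => ?_) (fun m hm h0 => ?_) hθ h)
  · have := Finset.mem_Icc.1 (hA.subset h0)
    omega
  · have := Finset.mem_Icc.1 (hA.subset h0)
    omega

theorem existsUnique_isHeadOf (hA : IsAdmissible A w) (τ : H w) : ∃! θ, IsHeadOf A w τ θ := by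
  obtain ⟨θ, hθ⟩ := exists_isHeadOf hA.one_le hA.parabolic_le τ
  refine ⟨θ, hθ, fun θ' hθ' => Subtype.ext (le_antisymm_idx ?_ ?_)⟩
  · refine hA.le_of_isHead hθ.1 fun m hm => ?_
    rw [← cnt_eq_of_reachable hθ.2 hm, ← cnt_eq_of_reachable hθ'.2 hm]
  · refine hA.le_of_isHead hθ'.1 fun m hm => ?_
    rw [← cnt_eq_of_reachable hθ.2 hm, ← cnt_eq_of_reachable hθ'.2 hm]

theorem isHeadOf_head (hA : IsAdmissible A w) (τ : H w) : IsHeadOf A w τ (head A w τ) :=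
  Classical.epsilon_spec (hA.existsUnique_isHeadOf τ).exists

theorem cnt_head (hA : IsAdmissible A w) (τ : H w) {m : ℕ} (hm : m ∉ A) :
    cnt m (head A w τ).1 = cnt m τ.1 :=
  (cnt_eq_of_reachable (hA.isHeadOf_head τ).2 hm).symm

theorem head_le_head (hA : IsAdmissible A w) {τ φ : H w}
    (h : ∀ m, m ∉ A → cnt m φ.1 ≤ cnt m τ.1) : head A w τ ≤ head A w φ :=
  hA.le_of_isHead (hA.isHeadOf_head φ).1 fun m hm => by
    rw [hA.cnt_head _ hm, hA.cnt_head _ hm]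
    exact h m hm

theorem head_eq_head (hA : IsAdmissible A w) {τ φ : H w}
    (h : ∀ m, m ∉ A → cnt m φ.1 = cnt m τ.1) : head A w τ = head A w φ :=
  Subtype.ext (le_antisymm_idx (hA.head_le_head fun m hm => (h m hm).le)
    (hA.head_le_head fun m hm => (h m hm).ge))

/-- A decrease of the partial sums of the boundary counts raises the degree `r` head. -/
theorem strGE_head (hA : IsAdmissible A w) {r : ℕ} {γ τ : Fin r → H w}
    (h : ∀ (q : Fin r) (m : ℕ), ∑ i ∈ Finset.Iic q, cnt m (γ i).1 ≤
      ∑ i ∈ Finset.Iic q, cnt m (τ i).1) :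
    StrGE (fun i => head A w (γ i)) (fun i => head A w (τ i)) := by
  by_cases heq : (fun i => head A w (γ i)) = fun i => head A w (τ i)
  · exact Or.inr heq
  obtain ⟨q, hq, hmin⟩ : ∃ q, head A w (γ q) ≠ head A w (τ q) ∧
      ∀ n < q, head A w (γ n) = head A w (τ n) := by
    obtain ⟨q, hq, hmin⟩ := WellFounded.has_min (wellFounded_lt (α := Fin r))
      {q | head A w (γ q) ≠ head A w (τ q)} (Function.ne_iff.1 heq)
    exact ⟨q, hq, fun n hn => by_contra fun hc => hmin n hc hn⟩
  -- Equal heads before `q` force equal boundary counts there, so the partial-sum inequality reduces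
  -- to its term at `q`.
  have hle : head A w (τ q) ≤ head A w (γ q) := by
    refine hA.head_le_head fun m hm => ?_
    have hsum := h q m
    rw [← Finset.Iio_insert, Finset.sum_insert (by simp), Finset.sum_insert (by simp)] at hsum
    have : ∑ i ∈ Finset.Iio q, cnt m (γ i).1 = ∑ i ∈ Finset.Iio q, cnt m (τ i).1 := by
      refine Finset.sum_congr rfl fun i hi => ?_
      rw [← hA.cnt_head _ hm, ← hA.cnt_head (τ i) hm, hmin i (Finset.mem_Iio.1 hi)]
    linarith
  exact Or.inl ⟨q, hmin, lt_of_le_not_ge hle fun hge => hq (Subtype.ext (le_antisymm_idx hge hle))⟩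

end IsAdmissible

end

section

variable {N d r : ℕ} {A : Finset ℕ} {w : Idx N d}

/-! ### Standard monomials on `X(w)` -/

/-- The tuple of indices underlying a standard tuple. -/
def StdTuple.val (γ : StdTuple w r) : Fin r → Idx N d := fun i => (γ.1 i).1

theorem StdTuple.val_injective : Function.Injective (StdTuple.val : StdTuple w r → _) :=
  fun _ _ h => Subtype.ext (funext fun i => Subtype.ext (congrFun h i))

theorem StdTuple.antitone_val (γ : StdTuple w r) : Antitone γ.val := fun i j hij => γ.2 i j hij

theorem exists_stdTuple {γ : Fin r → Idx N d} (h1 : Antitone γ) (h2 : ∀ i, γ i ≤ w) :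
    ∃ γ' : StdTuple w r, γ'.val = γ :=
  ⟨⟨fun i => ⟨γ i, h2 i⟩, fun _ _ hij => h1 hij⟩, rfl⟩

theorem eq_zero_of_sum_mono_eq_zero (hd : 1 ≤ d) {a : StdTuple w r → ℂ}
    (h : ∑ γ, a γ • mono w γ.1 = 0) : a = 0 := by
  have hinj := StdTuple.val_injective (w := w) (r := r)
  have h0 := eq_zero_of_sum_plProd_eq_zero (r := r) (w := w) hd
    (a := Function.extend StdTuple.val a 0) (fun γ hγ => ?_) ?_
  · funext γ
    rw [← hinj.extend_apply a (0 : (Fin r → Idx N d) → ℂ) γ, h0]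
    rfl
  · by_cases hex : ∃ γ' : StdTuple w r, γ'.val = γ
    · obtain ⟨γ', rfl⟩ := hex
      exact ⟨γ'.antitone_val, fun i => (γ'.1 i).2⟩
    · exact absurd (Function.extend_apply' a (0 : (Fin r → Idx N d) → ℂ) γ hex) hγ
  · rw [← h]
    symm
    refine Fintype.sum_of_injective _ hinj _ _ (fun γ hγ => ?_) fun γ => ?_
    · rw [Function.extend_apply' a (0 : (Fin r → Idx N d) → ℂ) γ hγ, Pi.zero_apply, zero_smul]
    · rw [hinj.extend_apply]
      rfl

namespace IsAdmissible

theorem exists_straightening (hA : IsAdmissible A w) (τ : Fin r → H w) :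
    ∃ a : StdTuple w r → ℂ, mono w τ = ∑ γ, a γ • mono w γ.1 ∧
      ∀ γ, a γ ≠ 0 → StrGE (fun i => head A w (γ.1 i)) (fun i => head A w (τ i)) := by
  obtain ⟨a, ha, hsum⟩ := exists_standard_expansion_majorized hA.one_le w fun i => (τ i).1
  refine ⟨fun γ => a γ.val, ?_, fun γ hγ => hA.strGE_head fun q m => ?_⟩
  · refine hsum.trans (Fintype.sum_of_injective _ StdTuple.val_injective _ _ (fun γ hγ => ?_)
      fun γ => rfl).symm
    by_cases h0 : a γ = 0
    · rw [h0, zero_smul]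
    · exact absurd (exists_stdTuple (ha γ h0).1.1 (ha γ h0).1.2) hγ
  · exact sum_cnt_le_of_majorized γ.antitone_val m ((ha _ hγ).2 m) q

theorem existsUnique_straightening (hA : IsAdmissible A w) (τ : Fin r → H w) :
    ∃! a : StdTuple w r → ℂ, mono w τ = ∑ γ, a γ • mono w γ.1 := by
  obtain ⟨a, ha, -⟩ := hA.exists_straightening τ
  refine ⟨a, ha, fun b hb => sub_eq_zero.1 (eq_zero_of_sum_mono_eq_zero (w := w) hA.one_le ?_)⟩
  simp only [Pi.sub_apply, sub_smul, Finset.sum_sub_distrib]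
  rw [← ha, ← hb, sub_self]

theorem strGE_of_straightening (hA : IsAdmissible A w) (τ : Fin r → H w) {a : StdTuple w r → ℂ}
    (ha : mono w τ = ∑ γ, a γ • mono w γ.1) {γ : StdTuple w r} (hγ : a γ ≠ 0) :
    StrGE (fun i => head A w (γ.1 i)) (fun i => head A w (τ i)) := by
  obtain ⟨b, hb, hb'⟩ := hA.exists_straightening τ
  rw [(hA.existsUnique_straightening τ).unique ha hb] at hγ
  exact hb' γ hγ

end IsAdmissible

theorem StrGT.trans {x y z : Fin r → H w} (h1 : StrGT x y) (h2 : StrGT y z) : StrGT x z := by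
  obtain ⟨q, hq, hlt⟩ := h1
  obtain ⟨q', hq', hlt'⟩ := h2
  rcases lt_trichotomy q q' with h | rfl | h
  · exact ⟨q, fun n hn => (hq n hn).trans (hq' n (hn.trans h)), hq' q h ▸ hlt⟩
  · exact ⟨q, fun n hn => (hq n hn).trans (hq' n hn), hlt'.trans hlt⟩
  · exact ⟨q', fun n hn => (hq n (hn.trans h)).trans (hq' n hn), (hq q' h).symm ▸ hlt'⟩

theorem StrGE.trans_strGT {x y z : Fin r → H w} (h1 : StrGE x y) (h2 : StrGT y z) : StrGT x z := by
  rcases h1 with h1 | rfl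
  · exact h1.trans h2
  · exact h2

theorem StrGE.trans {x y z : Fin r → H w} (h1 : StrGE x y) (h2 : StrGE y z) : StrGE x z := by
  rcases h2 with h2 | rfl
  · exact Or.inl (h1.trans_strGT h2)
  · exact h1

/-! ### The action of the Levi part -/

/-- A nonzero term of the determinant of a block diagonal matrix matches rows and columns within
blocks, so `τ` and `φ` have equally many elements in each block. -/
theorem cnt_eq_of_minor_ne_zero {g : GL (Fin N) ℂ} (hg : g ∈ levi N A) {τ φ : Idx N d}
    (h : minor (g : Matrix (Fin N) (Fin N) ℂ) τ φ ≠ 0) {m : ℕ} (hm : m ∉ A) :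
    cnt m τ = cnt m φ := by
  rw [minor, Matrix.det_apply] at h
  obtain ⟨σ, -, hσ⟩ := Finset.exists_ne_zero_of_sum_ne_zero h
  rw [cnt, cnt, wsum_eq_sum_enum, wsum_eq_sum_enum, ← Equiv.sum_comp σ]
  refine Finset.sum_congr rfl fun i _ => ?_
  have hb : block A (τ.enum (σ i)) = block A (φ.enum i) := by
    by_contra hb
    refine hσ ?_
    rw [Finset.prod_eq_zero (Finset.mem_univ i), smul_zero]
    exact hg _ _ hb
  have : (τ.enum (σ i)).val < m ↔ (φ.enum i).val < m := by
    constructor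
    · intro h1
      by_contra! h2
      exact (block_lt_of_notMem hm h1 h2).ne hb
    · intro h1
      by_contra! h2
      exact (block_lt_of_notMem hm h1 h2).ne' hb
  simp only [this]

theorem coordAct_pl (g : stabilizer w) (τ : Idx N d) :
    coordAct w g (pl w τ) = ∑ φ, minor ((g : GL (Fin N) ℂ)⁻¹ : GL (Fin N) ℂ).1 τ φ • pl w φ := by
  have h1 : coordAct w g (pl w τ) = Ideal.Quotient.mkₐ ℂ (vanishingIdeal w)
      (polyAct (g : GL (Fin N) ℂ) (MvPolynomial.X τ)) := rfl
  rw [h1, polyAct, MvPolynomial.aeval_X, map_sum]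
  refine Finset.sum_congr rfl fun φ _ => ?_
  rw [← MvPolynomial.smul_eq_C_mul, map_smul, plucker_extMap]
  rfl

theorem coordAct_mono (g : stabilizer w) (τ : Fin r → H w) :
    coordAct w g (mono w τ) = ∑ γ : Fin r → Idx N d,
      (∏ i, minor ((g : GL (Fin N) ℂ)⁻¹ : GL (Fin N) ℂ).1 (τ i).1 (γ i)) • plProd w γ := by
  rw [mono, map_prod]
  simp only [coordAct_pl]
  rw [Finset.prod_univ_sum, Fintype.piFinset_univ]
  refine Finset.sum_congr rfl fun γ _ => ?_
  rw [Finset.prod_smul, plProd]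

namespace IsAdmissible

/-- Expanding the action gives products whose nonzero terms have the heads of `τ` position by
position, though they need not be standard; straightening them only raises the heads. -/
theorem coordAct_mono_mem_span (hA : IsAdmissible A w) {g : GL (Fin N) ℂ} (hg : g ∈ levi N A)
    (hgw : g ∈ stabilizer w) (τ : Fin r → H w) :
    coordAct w ⟨g, hgw⟩ (mono w τ) ∈ Submodule.span ℂ
      (StdGE A w fun i => head A w (τ i)) := by
  rw [coordAct_mono]
  refine Submodule.sum_mem _ fun γ _ => ?_
  by_cases h0 : ∏ i, minor (g⁻¹ : GL (Fin N) ℂ).1 (τ i).1 (γ i) = 0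
  · rw [h0, zero_smul]
    exact Submodule.zero_mem _
  refine Submodule.smul_mem _ _ ?_
  by_cases hγ : ∀ i, γ i ≤ w
  · let γ' : Fin r → H w := fun i => ⟨γ i, hγ i⟩
    have hhead : (fun i => head A w (γ' i)) = fun i => head A w (τ i) := funext fun i =>
      hA.head_eq_head fun m hm => cnt_eq_of_minor_ne_zero ((levi N A).inv_mem hg)
        (Finset.prod_ne_zero_iff.1 h0 i (Finset.mem_univ i)) hm
    obtain ⟨a, ha, ha'⟩ := hA.exists_straightening γ'
    change mono w γ' ∈ _
    rw [ha, ← hhead]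
    refine Submodule.sum_mem _ fun δ _ => ?_
    by_cases hδ : a δ = 0
    · rw [hδ, zero_smul]
      exact Submodule.zero_mem _
    · exact Submodule.smul_mem _ _ (Submodule.subset_span ⟨δ.1, δ.2, ha' δ hδ, rfl⟩)
  · push Not at hγ
    obtain ⟨i, hi⟩ := hγ
    have : plProd w γ = 0 := Finset.prod_eq_zero (Finset.mem_univ i) (pl_eq_zero hA.one_le hi)
    rw [this]
    exact Submodule.zero_mem _

theorem coordAct_mem_span_stdGE (hA : IsAdmissible A w) (θ : Fin r → H w) {g : GL (Fin N) ℂ}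
    (hg : g ∈ levi N A) (hgw : g ∈ stabilizer w) {f : CoordRing w}
    (hf : f ∈ Submodule.span ℂ (StdGE A w θ)) :
    coordAct w ⟨g, hgw⟩ f ∈ Submodule.span ℂ (StdGE A w θ) := by
  suffices h : Submodule.span ℂ (StdGE A w θ) ≤
      (Submodule.span ℂ (StdGE A w θ)).comap (coordAct w ⟨g, hgw⟩).toLinearMap from h hf
  rw [Submodule.span_le]
  rintro _ ⟨τ, -, hτ, rfl⟩
  refine Submodule.span_mono ?_ (hA.coordAct_mono_mem_span hg hgw τ)
  rintro _ ⟨γ, hγ, hge, rfl⟩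
  exact ⟨γ, hγ, hge.trans hτ, rfl⟩

theorem coordAct_mem_span_stdGT (hA : IsAdmissible A w) (θ : Fin r → H w) {g : GL (Fin N) ℂ}
    (hg : g ∈ levi N A) (hgw : g ∈ stabilizer w) {f : CoordRing w}
    (hf : f ∈ Submodule.span ℂ (StdGT A w θ)) :
    coordAct w ⟨g, hgw⟩ f ∈ Submodule.span ℂ (StdGT A w θ) := by
  suffices h : Submodule.span ℂ (StdGT A w θ) ≤
      (Submodule.span ℂ (StdGT A w θ)).comap (coordAct w ⟨g, hgw⟩).toLinearMap from h hf
  rw [Submodule.span_le]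
  rintro _ ⟨τ, -, hτ, rfl⟩
  refine Submodule.span_mono ?_ (hA.coordAct_mono_mem_span hg hgw τ)
  rintro _ ⟨γ, hγ, hge, rfl⟩
  exact ⟨γ, hγ, hge.trans_strGT hτ, rfl⟩

end IsAdmissible

end

end SchubertLevi

end

/-- Straightening raises degree `r` heads, and the resulting `L`-stability. Here `Q = P_A` is a
standard parabolic subgroup contained in the stabilizer `Q_w` of `X(w)`, and `L = levi N A`. -/
theorem theorem3p3 (N d : ℕ) (hd : 1 ≤ d) (hdN : d ≤ N - 1) (w : SchubertLevi.Idx N d)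
    (A : Finset ℕ) (hA : A ⊆ Finset.Icc 1 (N - 1))
    (hQ : SchubertLevi.parabolic N A ≤ SchubertLevi.stabilizer w) :
    -- every element of `H_w` has a unique head
    (∀ τ : SchubertLevi.H w, ∃! θ : SchubertLevi.H w, SchubertLevi.IsHeadOf A w τ θ) ∧
    ∀ r : ℕ,
      -- straightening
      (∀ τ : Fin r → SchubertLevi.H w,
        (∃! a : SchubertLevi.StdTuple w r → ℂ,
          SchubertLevi.mono w τ = ∑ γ, a γ • SchubertLevi.mono w γ.1) ∧
        ∀ a : SchubertLevi.StdTuple w r → ℂ,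
          SchubertLevi.mono w τ = ∑ γ, a γ • SchubertLevi.mono w γ.1 →
          ∀ γ : SchubertLevi.StdTuple w r, a γ ≠ 0 →
            SchubertLevi.StrGE (fun i => SchubertLevi.head A w (γ.1 i))
              (fun i => SchubertLevi.head A w (τ i))) ∧
      -- stability under `L`
      (∀ θ : Fin r → SchubertLevi.H w, SchubertLevi.IsStdHead A θ →
        ∀ (g : GL (Fin N) ℂ) (hg : g ∈ SchubertLevi.levi N A),
          (∀ f ∈ Submodule.span ℂ (SchubertLevi.StdGE A w θ),
            SchubertLevi.coordAct w ⟨g, hQ (SchubertLevi.levi_le_parabolic N A hg)⟩ f ∈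
              Submodule.span ℂ (SchubertLevi.StdGE A w θ)) ∧
          (∀ f ∈ Submodule.span ℂ (SchubertLevi.StdGT A w θ),
            SchubertLevi.coordAct w ⟨g, hQ (SchubertLevi.levi_le_parabolic N A hg)⟩ f ∈
              Submodule.span ℂ (SchubertLevi.StdGT A w θ))) := by
  have h : SchubertLevi.IsAdmissible A w := ⟨hd, hA, hQ⟩
  exact ⟨h.existsUnique_isHeadOf, fun r => ⟨fun τ => ⟨h.existsUnique_straightening τ,
    fun a ha γ hγ => h.strGE_of_straightening τ ha hγ⟩, fun θ _ g hg =>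
      ⟨fun f hf => h.coordAct_mem_span_stdGE θ hg _ hf,
        fun f hf => h.coordAct_mem_span_stdGT θ hg _ hf⟩⟩⟩
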